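/- Let $T$ be a complete first-order theory in a language $L$, let $|T| = |L| + \aleph_0$, and let $\mathfrak C$ be a monster model of $T$, i.e. a $\kappa$-saturated model of $T$ for a large cardinal $\kappa$ (it is enough that $\kappa > |T|^+ + |A|^+$ for the set $A$ below). Let $A \subseteq \mathfrak C$, let $x$ be a finite tuple of variables, and let $p(x)$ be a consistent partial type over $A$. All sequences are indexed by infinite linear orders, and their terms are tuples from $\mathfrak C$. A family of sequences is mutually indiscernible over a set $B$ if each of its members is indiscernible over the union of $B$ and all the other members. * For a cardinal $\mu$, we say that $p$ has dp-rank $<\mu$ if for every realization $d$ of $p$ and every $\mu$ sequences that are mutually indiscernible over $A$, at least one of these sequences is indiscernible over $Ad$. The type $p$ is *dependent* if it has dp-rank $<\mu$ for some cardinal $\mu$ (where, as usual in a monster model, only small cardinals $\mu<\kappa$ are considered). * For $B \supseteq A$, the type $p$ is *$1$-independent over $B$* if there are a realization $d \models p$ and sequences $\langle I_i \mid i<\omega\rangle$ of singletons (elements of $\mathfrak C$), with a common index order and mutually indiscernible over $B$, such that the sequence $\langle I_i \mid i<\omega\rangle$, in which each $I_i$ is regarded as one (infinite) tuple, is indiscernible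 over $Bd$, and such that no $I_i$ is indiscernible over $Bd$. The type $p$ is *$1$-dependent* if it is not $1$-independent over any $A' \supseteq A$ with $A' \setminus A$ finite. * The type $p$ has *singleton shrinking of indiscernibles* if for every $A' \supseteq A$ with $A'\setminus A$ finite, every $A'$-indiscernible sequence $\langle a_i \mid i<|T|^+ + |A|^+\rangle$ of tuples satisfying $p$, and every singleton $c \in \mathfrak C$, there is some $\alpha<|T|^+ + |A|^+$ such that the end-segment $\langle a_i \mid \alpha<i\rangle$ is indiscernible over $A'c$. Then the following are equivalent: 1. $p$ is $1$-dependent; 2. $p$ is dependent; 3. $p$ has singleton shrinking of indiscernibles. -/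

import Mathlib

open Cardinal FirstOrder

universe u v w x y z

namespace DpRank

section Types

variable {L : FirstOrder.Language.{u, v}} {C : Type w} [L.Structure C]

/-- The tuple `a` satisfies every formula of `p(x)`, where `x = (x₀, …, xₙ₋₁)` and `p` is a set of
formulas with parameters in `A`. -/
def Realizes {A : Set C} {n : ℕ} (p : Set (L[[A]].Formula (Fin n))) (a : Fin n → C) : Prop :=
  ∀ φ ∈ p, φ.Realize a

/-- `p(x)` is finitely satisfiable in `C`, i.e. it is a (consistent, partial) type over `A`. -/
def IsConsistent {A : Set C} {n : ℕ} (p : Set (L[[A]].Formula (Fin n))) : Prop :=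
  ∀ q ⊆ p, q.Finite → ∃ a : Fin n → C, Realizes q a

/-- `C` is `κ`-saturated: every type in one variable over a set of fewer than `κ` parameters
is realized in `C`. -/
def IsSaturated (L : FirstOrder.Language.{u, v}) (C : Type w) [L.Structure C] (κ : Cardinal.{w}) : Prop :=
  ∀ B : Set C, #B < κ →
    ∀ p : Set (L[[B]].Formula (Fin 1)), IsConsistent p → ∃ c : Fin 1 → C, Realizes p c

end Types

section Sequences

variable (L : FirstOrder.Language.{u, v}) {C : Type w} [L.Structure C]

/-- The sequence `⟨a i | i ∈ ι⟩` of (possibly infinite) tuples `a i = (a i t)_{t ∈ τ}`, indexed by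
a linear order `ι`, is indiscernible over `B`: any two finite increasing subsequences of the same
length satisfy the same formulas with parameters in `B`. -/
def Indiscernible {ι : Type x} [LinearOrder ι] {τ : Type y} (B : Set C) (a : ι → τ → C) : Prop :=
  ∀ (m : ℕ) (s t : Fin m ↪o ι) (φ : L[[B]].Formula (Fin m × τ)),
    φ.Realize (fun j : Fin m × τ => a (s j.1) j.2) ↔
      φ.Realize (fun j : Fin m × τ => a (t j.1) j.2)

/-- The set of all elements of `C` occurring in some tuple of the sequence `a`. -/
def entries {ι : Type x} {τ : Type y} (a : ι → τ → C) : Set C :=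
  {c | ∃ i t, a i t = c}

/-- The sequences `⟨I k | k ∈ K⟩` are mutually indiscernible over `B`: each of them is indiscernible
over `B` together with all the other sequences. -/
def MutuallyIndiscernible {K : Type z} {ι : K → Type x} [∀ k, LinearOrder (ι k)]
    {τ : K → Type y} (B : Set C) (I : ∀ k, ι k → τ k → C) : Prop :=
  ∀ k, Indiscernible L (B ∪ ⋃ j ∈ {j : K | j ≠ k}, entries (I j)) (I k)

variable {L}

/-- The type `p` has dp-rank `< μ`: for any realization `d` of `p` and any `μ` (infinite) sequences
which are mutually indiscernible over `A`, at least one of them is indiscernible over `A ∪ d`. -/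
def DpRankLT {A : Set C} {n : ℕ} (p : Set (L[[A]].Formula (Fin n))) (μ : Cardinal.{w}) : Prop :=
  ∀ d : Fin n → C, Realizes p d →
    ∀ (K : Type w), #K = μ →
      ∀ (ι : K → Type w) [∀ k, LinearOrder (ι k)] [∀ k, Infinite (ι k)] (τ : K → Type w)
        (I : ∀ k, ι k → τ k → C),
        MutuallyIndiscernible L A I → ∃ k, Indiscernible L (A ∪ Set.range d) (I k)

/-- The type `p` is dependent, i.e. its dp-rank is not `∞`, where the cardinals that are considered
are the ones which are small with respect to the `κ`-saturated monster model `C`. -/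
def IsDependent (κ : Cardinal.{w}) {A : Set C} {n : ℕ} (p : Set (L[[A]].Formula (Fin n))) : Prop :=
  ∃ μ < κ, DpRankLT p μ

/-- The type `p` is `1`-independent over `B`: there are a realization `d` of `p` and sequences
`⟨I k | k < ω⟩` of singletons (with a common infinite index order `ι`), mutually indiscernible
over `B`, such that the sequence of the `I k`, each regarded as one `ι`-tuple, is indiscernible over
`B ∪ d`, and such that no `I k` is indiscernible over `B ∪ d`. -/
def IsOneIndependentOver {A : Set C} {n : ℕ} (p : Set (L[[A]].Formula (Fin n))) (B : Set C) :
    Prop :=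
  ∃ d : Fin n → C, Realizes p d ∧
    ∃ (ι : Type w) (_ : LinearOrder ι) (_ : Infinite ι) (I : ℕ → ι → C),
      MutuallyIndiscernible L B (fun k i (_ : Unit) => I k i) ∧
      Indiscernible L (B ∪ Set.range d) I ∧
      ∀ k, ¬ Indiscernible L (B ∪ Set.range d) (fun i (_ : Unit) => I k i)

/-- The type `p` over `A` is `1`-dependent: it is not `1`-independent over any `A' ⊇ A` with
`A' \ A` finite. -/
def IsOneDependent {A : Set C} {n : ℕ} (p : Set (L[[A]].Formula (Fin n))) : Prop :=
  ∀ A' : Set C, A ⊆ A' → (A' \ A).Finite → ¬ IsOneIndependentOver p A'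

variable (L)

/-- The cardinality `|T| = |L| + ℵ₀` of a complete theory `T` in the language `L`. -/
noncomputable def cardT : Cardinal.{max u v} := L.card + ℵ₀

/-- The cardinal `|T|⁺ + |A|⁺`. -/
noncomputable def shrinkingLength (A : Set C) : Cardinal.{max u v w} :=
  Cardinal.lift.{w} (Order.succ (cardT L)) + Cardinal.lift.{max u v} (Order.succ #A)

variable {L}

/-- Shrinking of indiscernibles over singletons, for the type `p` over `A`, with
`lam = |T|⁺ + |A|⁺`: for every `A' ⊇ A` with `A' \ A` finite, every `A'`-indiscernible sequence
`⟨a i | i < lam⟩` of realizations of `p` and every single element `c`, there is `α < lam` such that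
`⟨a i | α < i⟩` is indiscernible over `A' ∪ {c}`. -/
def SingletonShrinking {A : Set C} {n : ℕ} (p : Set (L[[A]].Formula (Fin n))) : Prop :=
  ∀ A' : Set C, A ⊆ A' → (A' \ A).Finite →
    ∀ a : (shrinkingLength L A).ord.ToType → Fin n → C, (∀ i, Realizes p (a i)) →
      Indiscernible L A' a →
        ∀ c : C, ∃ α, Indiscernible L (A' ∪ {c}) (fun i : Set.Ioi α => a i.1)

end Sequences

end DpRank

/-!
Write `D` for the set of realizations of `p`. Each of the three conditions is shown to be equivalent
to the failure of the independence property `HasIP L D`: there are no formula `φ(x, y)` and sequence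
`b₀, b₁, …` of finite tuples all of whose finite subsets are cut out by `φ(d, y)` for some `d ∈ D`.
As parameters can be appended to the `bᵢ`, this condition does not depend on a base set, which makes
it insensitive to the passage from `A` to a larger set.

*Dependence.* If none of many mutually indiscernible sequences is indiscernible over `Ad`, then by
the pigeonhole principle one formula distinguishes, with parameters `d`, two subfamilies of each of
infinitely many of them. Mutual indiscernibility allows an arbitrary choice between the
two subfamilies in each sequence without changing the type of the whole, so the copies of `d` given
by homogeneity produce the independence property (`shatters_of_sameTypeOver`,
`MutuallyIndiscernible.hasIP`). The same argument shows that `1`-independence implies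
it. Conversely, a shattered sequence can be taken indiscernible along any small linear order, with
all subsets cut out by elements of `D` (`ShattersFinite.exists_indiscernible`); its consecutive
blocks are mutually indiscernible, and one `d` disturbs all of them at once.

*Shrinking.* If an indiscernible sequence of length `λ = |T|⁺ + |A|⁺` has no end segment
indiscernible over `c`, then, `λ` being regular and larger than the number of formulas, the truth
value of one formula with parameters `c` alternates along consecutive blocks of the sequence, and
again the blocks are shattered by copies of `c` (`exists_shatters_of_not_indiscernible`).
Exchanging the roles of the variables (`exists_shattersFinite_singletons`), one obtains the
independence property for tuples of realizations of `p`, with a single element in place of `y`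
apart from fixed parameters. It passes to `p` itself, as otherwise a long sequence could be made
indiscernible over `d₁, …, dₘ` by adding the realizations `dᵢ` one by one and shrinking
(`hasIP_of_hasIP_tuplesIn`). Conversely, the independence property provides a long indiscernible
sequence in `D` along which a formula with parameters `c₁, …, cᵣ` alternates, so shrinking fails for
one of the `cᵢ`.

*Singletons.* If `p` has the independence property, then shrinking over some singleton fails, so
some tuple `d₁, …, dₘ` of realizations of `p` has, over a finite extension `B` of `A`,
sequences of singletons `I k` (`k ∈ ℚ`) of the kind required for `1`-independence
(`ShattersFinite.exists_mutuallyIndiscernible`). Then `m` can be lowered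
(`exists_isOneIndependentOver_of_tuple`). If the family is still mutually indiscernible over
`B d₁ … dₘ₋₁`, that set is the new base and `dₘ` shows that `p` is `1`-independent. If not, the
failure only involves finitely many entries of the sequences; adding these to `B` and restricting to
a small interval of `ℚ` yields witnesses for `d₁, …, dₘ₋₁`
(`exists_finite_of_not_mutuallyIndiscernible`).

Indiscernible sequences are extracted from arbitrary ones without Ramsey's theorem, as realizations
of the limit type along the iterated products of an ultrafilter on `ℕ`
(`IsSaturated.exists_indiscernible`).
-/

namespace DpRank

/-! ### Types of tuples -/

section SameType

variable {L : FirstOrder.Language.{u, v}} {C : Type w} [L.Structure C]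

variable (L) in
/-- The tuples `v` and `w`, of the same possibly infinite length, have the same type over `∅`. -/
def SameType {α : Type*} (v w : α → C) : Prop :=
  ∀ φ : L.Formula α, φ.Realize v ↔ φ.Realize w

variable (L) in
/-- The tuples `v` and `w` have the same type over `B`. Parameters are treated as further entries
of the tuples, so that this is a statement about formulas of `L` itself. -/
def SameTypeOver {α : Type*} (B : Set C) (v w : α → C) : Prop :=
  SameType L (Sum.elim ((↑) : B → C) v) (Sum.elim ((↑) : B → C) w)

variable {α : Type*} {β : Type*} {v w v' : α → C} {B B' : Set C}

theorem SameType.refl (v : α → C) : SameType L v v := fun _ => Iff.rfl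

theorem SameType.symm (h : SameType L v w) : SameType L w v := fun φ => (h φ).symm

theorem SameType.trans (h : SameType L v w) (h' : SameType L w v') : SameType L v v' :=
  fun φ => (h φ).trans (h' φ)

theorem SameType.comp (h : SameType L v w) (f : β → α) : SameType L (v ∘ f) (w ∘ f) := by
  intro φ
  simpa [Language.Formula.realize_relabel] using h (φ.relabel f)

theorem SameTypeOver.symm (h : SameTypeOver L B v w) : SameTypeOver L B w v :=
  SameType.symm h

theorem SameTypeOver.trans (h : SameTypeOver L B v w) (h' : SameTypeOver L B w v') :
    SameTypeOver L B v v' :=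
  SameType.trans h h'

/-- The main tool for changing tuples and bases: if each entry of the pair `(v', w')`, and each
parameter in `B'`, occurs as an entry of the pair `(v, w)` or is a parameter in `B`, then equality
of types is passed on from `(v, w)` over `B` to `(v', w')` over `B'`. -/
theorem SameTypeOver.subst {v : α → C} {w : α → C} (h : SameTypeOver L B v w) {v' w' : β → C}
    (hB : ∀ b ∈ B', b ∈ B ∨ ∃ y, v y = b ∧ w y = b)
    (hv : ∀ z, (v' z ∈ B ∧ w' z = v' z) ∨ ∃ y, v y = v' z ∧ w y = w' z) :
    SameTypeOver L B' v' w' := by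
  have key : ∀ z : B' ⊕ β, ∃ t : B ⊕ α,
      Sum.elim ((↑) : B → C) v t = Sum.elim ((↑) : B' → C) v' z ∧
      Sum.elim ((↑) : B → C) w t = Sum.elim ((↑) : B' → C) w' z := by
    rintro (⟨b, hb⟩ | z)
    · rcases hB b hb with h | ⟨y, h1, h2⟩
      · exact ⟨Sum.inl ⟨b, h⟩, rfl, rfl⟩
      · exact ⟨Sum.inr y, h1, h2⟩
    · rcases hv z with ⟨h1, h2⟩ | ⟨y, h1, h2⟩
      · exact ⟨Sum.inl ⟨_, h1⟩, rfl, h2.symm⟩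
      · exact ⟨Sum.inr y, h1, h2⟩
  choose f hf1 hf2 using key
  have := SameType.comp h f
  rwa [show Sum.elim ((↑) : B → C) v ∘ f = _ from funext hf1,
    show Sum.elim ((↑) : B → C) w ∘ f = _ from funext hf2] at this

theorem SameTypeOver.comp (h : SameTypeOver L B v w) (f : β → α) :
    SameTypeOver L B (v ∘ f) (w ∘ f) :=
  h.subst (fun _ hb => Or.inl hb) fun z => Or.inr ⟨f z, rfl, rfl⟩

theorem SameTypeOver.mono (h : SameTypeOver L B v w) (hB : B' ⊆ B) : SameTypeOver L B' v w :=
  h.subst (fun _ hb => Or.inl (hB hb)) fun z => Or.inr ⟨z, rfl, rfl⟩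

/-- Every formula involves only finitely many of its variables. The variables indexed by `σ` are
left alone. -/
theorem exists_fin_formula {σ : Type*} (φ : L.Formula (σ ⊕ α)) :
    ∃ (r : ℕ) (f : Fin r → α) (ψ : L.Formula (σ ⊕ Fin r)),
      ∀ (v : σ → C) (w : α → C),
        φ.Realize (Sum.elim v w) ↔ ψ.Realize (Sum.elim v (w ∘ f)) := by
  classical
  let S : Finset α := φ.freeVarFinset.toRight
  let g : φ.freeVarFinset → σ ⊕ Fin S.card := fun x =>
    match x with
    | ⟨Sum.inl s, _⟩ => Sum.inl s
    | ⟨Sum.inr a, h⟩ => Sum.inr (S.equivFin ⟨a, by simpa [S] using h⟩)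
  refine ⟨S.card, fun j => (S.equivFin.symm j : α), φ.restrictFreeVar g, fun v w => ?_⟩
  refine (Language.BoundedFormula.realize_restrictFreeVar _ ?_).symm
  rintro ⟨s | a, h⟩ <;> simp [g]

theorem realize_congr_freeVar [DecidableEq α] (φ : L.Formula α)
    (h : ∀ a ∈ φ.freeVarFinset, v a = w a) : φ.Realize v ↔ φ.Realize w := by
  have h1 := Language.BoundedFormula.realize_restrictFreeVar (φ := φ) (f := id)
    (v := fun a => v a) (xs := (default : Fin 0 → C)) v (by simp)
  have h2 := Language.BoundedFormula.realize_restrictFreeVar (φ := φ) (f := id)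
    (v := fun a => v a) (xs := (default : Fin 0 → C)) w (fun a => h _ a.2)
  exact h1.symm.trans h2

theorem SameType.of_finset
    (h : ∀ F : Finset α, ∃ w', SameType L v w' ∧ ∀ a ∈ F, w' a = w a) : SameType L v w := by
  classical
  intro φ
  obtain ⟨w', h1, h2⟩ := h φ.freeVarFinset
  exact (h1 φ).trans (realize_congr_freeVar φ h2)

theorem SameTypeOver.of_finset
    (h : ∀ F : Finset α, ∃ w', SameTypeOver L B v w' ∧ ∀ a ∈ F, w' a = w a) :
    SameTypeOver L B v w := by
  refine SameType.of_finset fun F => ?_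
  obtain ⟨w', h1, h2⟩ := h F.toRight
  refine ⟨_, h1, ?_⟩
  rintro (b | a) ha
  · rfl
  · exact h2 a (by simpa using ha)

/-- Two tuples have the same type if all their finite subtuples have. -/
theorem SameTypeOver.of_fin
    (h : ∀ (r : ℕ) (f : Fin r → α), SameTypeOver L B (v ∘ f) (w ∘ f)) : SameTypeOver L B v w := by
  intro φ
  obtain ⟨r, f, ψ, hψ⟩ := exists_fin_formula (C := C) φ
  rw [hψ, hψ]
  exact h r f ψ

/-- If two tuples have different types over `B ∪ O`, then finitely many parameters in `O` suffice
to distinguish them. -/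
theorem exists_finite_not_sameTypeOver {O : Set C} (h : ¬ SameTypeOver L (B ∪ O) v w) :
    ∃ G ⊆ O, G.Finite ∧ ¬ SameTypeOver L (B ∪ G) v w := by
  classical
  simp only [SameTypeOver, SameType, not_forall] at h
  obtain ⟨φ, hφ⟩ := h
  let F := φ.freeVarFinset.toLeft.image Subtype.val
  refine ⟨O ∩ F, Set.inter_subset_left, F.finite_toSet.inter_of_right _, fun hs => hφ ?_⟩
  obtain ⟨f, hf⟩ : ∃ f : φ.freeVarFinset → ((B ∪ (O ∩ F) : Set C)) ⊕ α,
      ∀ u : α → C, ∀ a, Sum.elim (↑) u (f a) = Sum.elim ((↑) : ↑(B ∪ O) → C) u a := by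
    refine ⟨fun x => match x with
      | ⟨Sum.inl b, hb⟩ => Sum.inl ⟨b, by
          rcases b.2 with h | h
          · exact Or.inl h
          · refine Or.inr ⟨h, ?_⟩
            simp only [F, Finset.coe_image, Set.mem_image, Finset.mem_coe, Finset.mem_toLeft]
            exact ⟨b, hb, rfl⟩⟩
      | ⟨Sum.inr a, _⟩ => Sum.inr a, ?_⟩
    rintro u ⟨b | a, hb⟩ <;> rfl
  have h1 := Language.BoundedFormula.realize_restrictFreeVar (φ := φ) (f := f)
    (v := Sum.elim (↑) v) (xs := (default : Fin 0 → C)) _ (hf v)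
  have h2 := Language.BoundedFormula.realize_restrictFreeVar (φ := φ) (f := f)
    (v := Sum.elim (↑) w) (xs := (default : Fin 0 → C)) _ (hf w)
  exact h1.symm.trans ((hs _).trans h2)

/-- A difference between the types of two tuples over a finite tuple `d` and a set `B` is witnessed
by a formula without parameters and finitely many entries or parameters in `B`. -/
theorem exists_formula_of_not_sameTypeOver {σ : Type*} {d : σ → C}
    (h : ¬ SameTypeOver L (B ∪ Set.range d) v w) :
    ∃ (r : ℕ) (f : Fin r → B ⊕ α) (ψ : L.Formula (σ ⊕ Fin r)),
      ψ.Realize (Sum.elim d (Sum.elim (↑) v ∘ f)) ∧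
      ¬ ψ.Realize (Sum.elim d (Sum.elim (↑) w ∘ f)) := by
  have h' : ¬ SameType L (Sum.elim d (Sum.elim ((↑) : B → C) v))
      (Sum.elim d (Sum.elim ((↑) : B → C) w)) := by
    intro hs
    apply h
    have key : ∀ z : ↑(B ∪ Set.range d) ⊕ α, ∃ t : σ ⊕ (B ⊕ α), ∀ u : α → C,
        Sum.elim d (Sum.elim ((↑) : B → C) u) t =
          Sum.elim ((↑) : ↑(B ∪ Set.range d) → C) u z := by
      rintro (⟨b, hb | ⟨s, rfl⟩⟩ | a)
      · exact ⟨Sum.inr (Sum.inl ⟨b, hb⟩), fun _ => rfl⟩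
      · exact ⟨Sum.inl s, fun _ => rfl⟩
      · exact ⟨Sum.inr (Sum.inr a), fun _ => rfl⟩
    choose f hf using key
    have := hs.comp f
    rwa [show Sum.elim d (Sum.elim ((↑) : B → C) v) ∘ f = _ from funext fun z => hf z v,
      show Sum.elim d (Sum.elim ((↑) : B → C) w) ∘ f = _ from funext fun z => hf z w] at this
  simp only [SameType, not_forall] at h'
  obtain ⟨φ, hφ⟩ := h'
  obtain ⟨r, f, ψ, hψ⟩ := exists_fin_formula (C := C) φ
  rw [hψ, hψ] at hφ
  by_cases hv : ψ.Realize (Sum.elim d (Sum.elim (↑) v ∘ f))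
  · exact ⟨r, f, ψ, hv, fun hw => hφ (iff_of_true hv hw)⟩
  · refine ⟨r, f, ψ.not, hv, fun hw => hφ (iff_of_false hv hw)⟩

end SameType

/-! ### Indiscernible sequences -/

section Indiscernibles

variable {L : FirstOrder.Language.{u, v}} {C : Type w} [L.Structure C] {B B' : Set C}

theorem forall_formula_iff_sameTypeOver {α : Type*} {v w : α → C} :
    (∀ φ : L[[B]].Formula α, φ.Realize v ↔ φ.Realize w) ↔ SameTypeOver L B v w := by
  have key : ∀ (φ : L[[B]].Formula α) (v : α → C), Language.Formula.Realize
      (show L.Formula (B ⊕ α) from Language.BoundedFormula.constantsVarsEquiv φ)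
      (Sum.elim ((↑) : B → C) v) ↔ φ.Realize v := by
    intro φ v
    exact Language.BoundedFormula.realize_constantsVarsEquiv (φ := φ) (v := v)
  constructor
  · intro h ψ
    have := h (Language.BoundedFormula.constantsVarsEquiv.symm ψ)
    rw [← key, ← key] at this
    simpa using this
  · intro h φ
    rw [← key, ← key]
    exact h _

theorem indiscernible_iff {ι : Type*} [LinearOrder ι] {τ : Type*} {a : ι → τ → C} :
    Indiscernible L B a ↔ ∀ (m : ℕ) (s t : Fin m ↪o ι),
      SameTypeOver L B (fun j : Fin m × τ => a (s j.1) j.2) (fun j => a (t j.1) j.2) := by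
  simp only [Indiscernible, ← forall_formula_iff_sameTypeOver]

theorem Indiscernible.mono {ι : Type*} [LinearOrder ι] {τ : Type*} {a : ι → τ → C}
    (h : Indiscernible L B a) (hB : B' ⊆ B) : Indiscernible L B' a := by
  rw [indiscernible_iff] at h ⊢
  exact fun m s t => (h m s t).mono hB

theorem Indiscernible.comp {ι ι' : Type*} [LinearOrder ι] [LinearOrder ι'] {τ : Type*}
    {a : ι → τ → C} (h : Indiscernible L B a) (g : ι' ↪o ι) :
    Indiscernible L B (fun i => a (g i)) := by
  rw [indiscernible_iff] at h ⊢
  exact fun m s t => h m (s.trans g) (t.trans g)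

/-- In an indiscernible sequence, subfamilies with the same order pattern have the same type. -/
theorem Indiscernible.sameTypeOver {ι : Type*} [LinearOrder ι] {τ : Type*} {a : ι → τ → C}
    (h : Indiscernible L B a) {Z : Type*} {f g : Z → ι}
    (hfg : ∀ z z', f z < f z' ↔ g z < g z') :
    SameTypeOver L B (fun z : Z × τ => a (f z.1) z.2) (fun z => a (g z.1) z.2) := by
  classical
  rw [indiscernible_iff] at h
  refine SameTypeOver.of_fin fun r q => ?_
  let S : Finset ι := Finset.univ.image fun j => f (q j).1
  have hS : ∀ j, f (q j).1 ∈ S := fun j => Finset.mem_image_of_mem _ (Finset.mem_univ j)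
  let s : Fin S.card ≃o S := S.orderIsoOfFin rfl
  have key : ∀ x : S, ∃ j, f (q j).1 = x := by
    rintro ⟨x, hx⟩
    simpa [S] using hx
  choose k hk using key
  have hfg' : ∀ z z', f z = f z' → g z = g z' := by
    intro z z' hz
    apply le_antisymm
    · exact not_lt.1 fun h => (((hfg _ _).2 h).ne hz.symm)
    · exact not_lt.1 fun h => (((hfg _ _).2 h).ne hz)
  let t : Fin S.card ↪o ι := OrderEmbedding.ofStrictMono (fun i => g (q (k (s i))).1) (by
    intro i i' hi
    rw [← hfg, hk, hk]
    exact s.strictMono hi)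
  have := (h S.card (s.toOrderEmbedding.trans (OrderEmbedding.subtype _)) t)
  refine this.subst (fun _ hb => Or.inl hb) fun j => Or.inr
    ⟨(s.symm ⟨_, hS j⟩, (q j).2), ?_, ?_⟩
  · simp
  · have e : g (q (k (s (s.symm ⟨_, hS j⟩)))).1 = g (q j).1 := hfg' _ _ (by rw [hk]; simp)
    exact congrArg (fun x => a x (q j).2) e

end Indiscernibles

/-! ### Realizing types in saturated structures -/

section Saturation

variable {L : FirstOrder.Language.{u, v}} {C : Type w} [L.Structure C] {κ : Cardinal.{w}}

/-- A finite family of formulas is jointly satisfied by some finite tuple if and only if a certain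
formula without these variables holds. -/
theorem exists_formula_exists {α σ : Type*} [Finite σ] {Γ : Set (L.Formula (α ⊕ σ))}
    (hΓ : Γ.Finite) :
    ∃ θ : L.Formula α, ∀ v : α → C,
      θ.Realize v ↔ ∃ d : σ → C, ∀ ψ ∈ Γ, ψ.Realize (Sum.elim v d) := by
  have := hΓ.to_subtype
  refine ⟨(Language.Formula.iInf fun ψ : Γ => (ψ : L.Formula (α ⊕ σ))).iExs σ, fun v => ?_⟩
  simp [Language.Formula.realize_iExs, Language.Formula.realize_iInf]

theorem IsSaturated.exists_realize_unit (hC : IsSaturated L C κ) {β : Type*} {e : β → C}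
    (he : #(Set.range e) < κ) {Γ : Set (L.Formula (β ⊕ Unit))}
    (hΓ : ∀ Γ₀ ⊆ Γ, Γ₀.Finite → ∃ d : Unit → C, ∀ ψ ∈ Γ₀, ψ.Realize (Sum.elim e d)) :
    ∃ d : Unit → C, ∀ ψ ∈ Γ, ψ.Realize (Sum.elim e d) := by
  let F : L.Formula (β ⊕ Unit) → L[[Set.range e]].Formula (Fin 1) := fun ψ =>
    Language.BoundedFormula.constantsVarsEquiv.symm
      (Language.Formula.relabel (Sum.map (Set.rangeFactorization e) fun _ => (0 : Fin 1)) ψ)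
  have hF : ∀ ψ (a : Fin 1 → C), (F ψ).Realize a ↔ ψ.Realize (Sum.elim e fun _ => a 0) := by
    intro ψ a
    have h1 := Language.BoundedFormula.realize_constantsVarsEquiv (M := C) (φ := F ψ) (v := a)
      (xs := default)
    simp only [F, Equiv.apply_symm_apply] at h1
    refine h1.symm.trans (Language.Formula.realize_relabel.trans (iff_of_eq (congrArg _ ?_)))
    funext z
    rcases z with z | z <;> rfl
  obtain ⟨c, hc⟩ := hC _ he (F '' Γ) (by
    intro q hq hfin
    obtain ⟨Γ₀, h1, h2, rfl⟩ := Set.exists_subset_image_finite_and.1 ⟨q, hq, hfin, rfl⟩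
    obtain ⟨d, hd⟩ := hΓ Γ₀ h1 h2
    refine ⟨fun _ => d (), ?_⟩
    rintro _ ⟨ψ, hψ, rfl⟩
    rw [hF]
    exact hd ψ hψ)
  exact ⟨fun _ => c 0, fun ψ hψ => (hF ψ c).1 (hc _ ⟨ψ, hψ, rfl⟩)⟩

/-- An ultrafilter `V` on the set of `σ`-tuples determines a complete type over the parameters `e`;
`IsLimit e V T d` says that the entries of `d` in `T` realize the restriction of that type to the
variables in `T`. -/
def IsLimit (L : FirstOrder.Language.{u, v}) {C : Type w} [L.Structure C] {β σ : Type*} (e : β → C)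
    (V : Ultrafilter (σ → C)) (T : Set σ) (d : σ → C) : Prop :=
  ∀ (r : ℕ) (f : Fin r → σ), (∀ i, f i ∈ T) → ∀ ψ : L.Formula (β ⊕ Fin r),
    ψ.Realize (Sum.elim e (d ∘ f)) ↔ ∀ᶠ d' in V, ψ.Realize (Sum.elim e (d' ∘ f))

theorem IsLimit.realize_iff {β σ : Type*} {e : β → C} {V : Ultrafilter (σ → C)} {T : Set σ}
    {d : σ → C} (h : IsLimit L e V T d) (ψ : L.Formula (β ⊕ T)) :
    ψ.Realize (Sum.elim e fun t : T => d t) ↔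
      ∀ᶠ d' : σ → C in V, ψ.Realize (Sum.elim e fun t : T => d' t) := by
  obtain ⟨r, f, ψ', hψ'⟩ := exists_fin_formula (C := C) ψ
  simp only [hψ']
  exact h r (fun i => f i) (fun i => (f i).2) ψ'

theorem IsLimit.congr {β σ : Type*} {e : β → C} {V : Ultrafilter (σ → C)} {T : Set σ}
    {d d₁ : σ → C} (h : IsLimit L e V T d) (hd : ∀ t ∈ T, d t = d₁ t) : IsLimit L e V T d₁ := by
  intro r f hf ψ
  rw [← h r f hf ψ, show d₁ ∘ f = d ∘ f from funext fun i => (hd _ (hf i)).symm]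

theorem IsLimit.exists_insert (hC : IsSaturated L C κ) (hκ : ℵ₀ ≤ κ) {β : Type*} {σ : Type x}
    {e : β → C} (he : #(Set.range e) < κ) {V : Ultrafilter (σ → C)} {T : Set σ}
    (hT : Cardinal.lift.{w} #T < Cardinal.lift.{x} κ) {d : σ → C} (h : IsLimit L e V T d) {s : σ}
    (hs : s ∉ T) : ∃ d₁, (∀ t ∈ T, d₁ t = d t) ∧ IsLimit L e V (insert s T) d₁ := by
  classical
  let Γ : Set (L.Formula ((β ⊕ T) ⊕ Unit)) :=
    {ψ | ∀ᶠ d' : σ → C in V, ψ.Realize (Sum.elim (Sum.elim e fun t : T => d' t) fun _ => d' s)}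
  have hcard : #(Set.range (Sum.elim e fun t : T => d t)) < κ := by
    rw [Set.Sum.elim_range]
    refine (mk_union_le _ _).trans_lt (add_lt_of_lt hκ he ?_)
    rw [← Cardinal.lift_lt.{w, x}]
    exact mk_range_le_lift.trans_lt hT
  obtain ⟨y, hy⟩ := hC.exists_realize_unit hcard (Γ := Γ) (by
    intro Γ₀ h1 h2
    obtain ⟨θ, hθ⟩ := exists_formula_exists (C := C) h2
    rw [← hθ, h.realize_iff]
    have : ∀ᶠ d' : σ → C in V, ∀ ψ ∈ Γ₀,
        ψ.Realize (Sum.elim (Sum.elim e fun t : T => d' t) fun _ => d' s) :=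
      (Set.Finite.eventually_all h2).2 fun ψ hψ => h1 hψ
    filter_upwards [this] with d' hd'
    exact (hθ _).2 ⟨_, hd'⟩)
  have hy' : ∀ ψ : L.Formula ((β ⊕ T) ⊕ Unit),
      ψ.Realize (Sum.elim (Sum.elim e fun t : T => d t) y) ↔ ψ ∈ Γ := by
    refine fun ψ => ⟨fun h => ?_, hy ψ⟩
    by_contra hn
    have : ψ.not ∈ Γ := by
      simp only [Γ, Set.mem_ofPred_eq, Language.Formula.realize_not]
      exact Ultrafilter.eventually_not.2 hn
    exact hy _ this h
  refine ⟨Function.update d s (y ()), fun t ht => ?_, fun r f hf ψ => ?_⟩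
  · rw [Function.update_of_ne]
    rintro rfl
    exact hs ht
  · let g : β ⊕ Fin r → (β ⊕ T) ⊕ Unit := Sum.elim (fun b => Sum.inl (Sum.inl b)) fun i =>
      if hi : f i = s then Sum.inr () else Sum.inl (Sum.inr ⟨f i, (hf i).resolve_left hi⟩)
    have hg : ∀ d' : σ → C, Sum.elim e (d' ∘ f) =
        Sum.elim (Sum.elim e fun t : T => d' t) (fun _ => d' s) ∘ g := by
      intro d'
      funext z
      rcases z with b | i
      · rfl
      · by_cases hi : f i = s <;> simp [g, hi]
    have hg' : Sum.elim e (Function.update d s (y ()) ∘ f) =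
        Sum.elim (Sum.elim e fun t : T => d t) y ∘ g := by
      funext z
      rcases z with b | i
      · rfl
      · by_cases hi : f i = s
        · simp [g, hi]
        · simp [g, hi]
    have := hy' (ψ.relabel g)
    simp only [Γ, Set.mem_ofPred_eq, Language.Formula.realize_relabel] at this
    rw [hg', this]
    simp only [hg]

/-- In a `κ`-saturated structure, the type determined by an ultrafilter on tuples is realized,
for tuples of length less than `κ` and fewer than `κ` parameters. The entries of a realization are
found one after the other along a well-order. -/
theorem IsSaturated.exists_isLimit (hC : IsSaturated L C κ) (hκ : ℵ₀ ≤ κ) {β : Type*} {σ : Type x}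
    {e : β → C} (he : #(Set.range e) < κ) (hσ : Cardinal.lift.{w} #σ < Cardinal.lift.{x} κ)
    (V : Ultrafilter (σ → C)) : ∃ d, IsLimit L e V Set.univ d := by
  classical
  let _ : LinearOrder σ := linearOrderOfSTO WellOrderingRel
  have _ : WellFoundedLT σ := ⟨WellOrderingRel.isWellOrder.wf⟩
  obtain ⟨d₀, -⟩ := V.nonempty_of_mem Filter.univ_mem
  -- `G s f y` is `f` below `s` and `y` from `s` on; only its values up to `s` matter.
  let G (s : σ) (f : ∀ t, t < s → C) (y : C) : σ → C := fun t => if h : t < s then f t h else y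
  let d : σ → C := (wellFounded_lt (α := σ)).fix fun s f =>
    if h : ∃ y, IsLimit L e V (Set.Iic s) (G s f y) then h.choose else d₀ s
  have hd : ∀ s, d s = if h : ∃ y, IsLimit L e V (Set.Iic s) (G s (fun t _ => d t) y)
      then h.choose else d₀ s := fun s => WellFounded.fix_eq _ _ _
  -- Formulas involve finitely many variables, so only proper initial segments have to be checked.
  have hunion : ∀ T : Set σ, (∀ t ∈ T, IsLimit L e V (Set.Iic t) d ∧ Set.Iic t ⊆ T) →
      IsLimit L e V T d := by
    intro T hT r f hf ψ
    rcases r.eq_zero_or_pos with rfl | hr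
    · have : ∀ d' : σ → C, d' ∘ f = default := fun d' => Subsingleton.elim _ _
      simp only [this]
      exact Filter.eventually_const.symm
    · have : Nonempty (Fin r) := ⟨⟨0, hr⟩⟩
      obtain ⟨i, hi⟩ := Finite.exists_max f
      exact (hT _ (hf i)).1 r f hi ψ
  have key : ∀ s, IsLimit L e V (Set.Iic s) d := by
    intro s
    induction s using WellFoundedLT.induction with
    | ind s ih =>
      have h1 : IsLimit L e V (Set.Iio s) d :=
        hunion _ fun t ht => ⟨ih t ht, fun t' ht' => (show t' ≤ t from ht').trans_lt ht⟩
      obtain ⟨d₁, h2, h3⟩ := h1.exists_insert hC hκ he (T := Set.Iio s) (s := s)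
        ((Cardinal.lift_le.2 (mk_set_le _)).trans_lt hσ) (lt_irrefl s)
      have h4 : ∃ y, IsLimit L e V (Set.Iic s) (G s (fun t _ => d t) y) := by
        refine ⟨d₁ s, ?_⟩
        rw [Set.Iio_insert] at h3
        refine h3.congr fun t ht => ?_
        rcases (show t ≤ s from ht).lt_or_eq with h | rfl
        · simp [G, h, h2 t h]
        · simp [G]
      refine h4.choose_spec.congr fun t ht => ?_
      rcases (show t ≤ s from ht).lt_or_eq with h | rfl
      · simp [G, h]
      · rw [hd t, dif_pos h4]
        simp [G]
  exact ⟨d, hunion _ fun t _ => ⟨key t, Set.subset_univ _⟩⟩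

/-- Finitely satisfiable sets of formulas in fewer than `κ` variables are realized. -/
theorem IsSaturated.exists_realize (hC : IsSaturated L C κ) (hκ : ℵ₀ ≤ κ) {β : Type*} {σ : Type x}
    {e : β → C} (he : #(Set.range e) < κ) (hσ : Cardinal.lift.{w} #σ < Cardinal.lift.{x} κ)
    {Γ : Set (L.Formula (β ⊕ σ))}
    (hΓ : ∀ Γ₀ : Finset (L.Formula (β ⊕ σ)), ↑Γ₀ ⊆ Γ →
      ∃ d : σ → C, ∀ ψ ∈ Γ₀, ψ.Realize (Sum.elim e d)) :
    ∃ d : σ → C, ∀ ψ ∈ Γ, ψ.Realize (Sum.elim e d) := by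
  classical
  obtain ⟨V, hV⟩ := Ultrafilter.exists_ultrafilter_of_finite_inter_nonempty
    ((fun ψ => {d : σ → C | ψ.Realize (Sum.elim e d)}) '' Γ) (by
      intro S hS
      obtain ⟨Γ₀, h1, rfl⟩ := Finset.subset_set_image_iff.1 hS
      obtain ⟨d, hd⟩ := hΓ Γ₀ h1
      exact ⟨d, by simpa using hd⟩)
  obtain ⟨d, hd⟩ := hC.exists_isLimit hκ he hσ V
  refine ⟨d, fun ψ hψ => ?_⟩
  obtain ⟨r, f, ψ', hψ'⟩ := exists_fin_formula (C := C) ψ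
  rw [hψ', hd r f (fun _ => Set.mem_univ _)]
  simp only [← hψ']
  exact hV ⟨ψ, hψ, rfl⟩

/-- Homogeneity: a finite tuple `d` over `v` can be copied over each tuple with the same type as
`v`. -/
theorem IsSaturated.exists_sameType (hC : IsSaturated L C κ) (hκ : ℵ₀ ≤ κ) {α : Type*}
    {σ : Type x} [Finite σ] {v w : α → C} (hw : #(Set.range w) < κ) (h : SameType L v w)
    (d : σ → C) : ∃ d', SameType L (Sum.elim v d) (Sum.elim w d') := by
  obtain ⟨d', hd'⟩ := hC.exists_realize hκ hw
    ((Cardinal.lift_lt_aleph0.2 (mk_lt_aleph0 (α := σ))).trans_le (aleph0_le_lift.2 hκ))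
    (Γ := {ψ : L.Formula (α ⊕ σ) | ψ.Realize (Sum.elim v d)}) (by
      intro Γ₀ h0
      obtain ⟨θ, hθ⟩ := exists_formula_exists (C := C) Γ₀.finite_toSet
      exact (hθ w).1 ((h θ).1 ((hθ v).2 ⟨d, h0⟩)))
  refine ⟨d', fun ψ => ⟨hd' ψ, fun hψ => ?_⟩⟩
  by_contra hn
  exact hd' ψ.not hn hψ

end Saturation

/-! ### Extraction of indiscernible sequences -/

section EhrenfeuchtMostowski

open Filter

/-- The iterated product of a non-principal ultrafilter on `ℕ`, an ultrafilter on increasing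
`N`-tuples: a set is large if for most `k₀`, for most `k₁`, …, the tuple `(k₀, k₁, …)` is in it.
-/
noncomputable def iterUltrafilter : (N : ℕ) → Ultrafilter (Fin N → ℕ)
  | 0 => pure Fin.elim0
  | N + 1 => (hyperfilter ℕ).bind fun k => (iterUltrafilter N).map (Fin.cons k)

theorem mem_iterUltrafilter_succ {N : ℕ} {s : Set (Fin (N + 1) → ℕ)} :
    s ∈ iterUltrafilter (N + 1) ↔
      ∀ᶠ k in hyperfilter ℕ, {f : Fin N → ℕ | Fin.cons k f ∈ s} ∈ iterUltrafilter N :=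
  Iff.rfl

/-- Most tuples are increasing, with entries beyond any given bound. -/
theorem strictMono_mem_iterUltrafilter (N K : ℕ) :
    {f : Fin N → ℕ | StrictMono f ∧ ∀ i, K < f i} ∈ iterUltrafilter N := by
  induction N generalizing K with
  | zero =>
    exact Filter.mem_of_superset Filter.univ_mem fun f _ => ⟨fun i => i.elim0, fun i => i.elim0⟩
  | succ N ih =>
    rw [mem_iterUltrafilter_succ]
    have h1 : ∀ᶠ k in (hyperfilter ℕ : Filter ℕ), K < k :=
      Nat.hyperfilter_le_atTop (eventually_gt_atTop K)
    filter_upwards [h1] with k hk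
    refine Filter.mem_of_superset (ih k) ?_
    rintro f ⟨h2, h3⟩
    refine ⟨?_, ?_⟩
    · refine Fin.strictMono_iff_lt_succ.2 ?_
      intro i
      cases N with
      | zero => exact i.elim0
      | succ N =>
        refine Fin.cases ?_ (fun i => ?_) i
        · simpa using h3 0
        · rw [← Fin.succ_castSucc]
          simp only [Fin.cons_succ]
          exact h2 (Fin.castSucc_lt_succ)
    · refine Fin.cases ?_ fun i => ?_
      · simpa using hk
      · simpa using hk.trans (h3 i)

theorem cons_eq_apply_pred {N : ℕ} (k : ℕ) (f : Fin N → ℕ) {j : Fin (N + 1)} (hj : j ≠ 0) :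
    (Fin.cons k f : Fin (N + 1) → ℕ) j = f (j.pred hj) := by
  conv_lhs => rw [← Fin.succ_pred j hj]
  rfl

/-- The iterated products are coherent: forgetting some of the entries of `N`-tuples yields the
product for shorter tuples. -/
theorem map_iterUltrafilter {M N : ℕ} (g : Fin M → Fin N) (hg : StrictMono g) :
    (iterUltrafilter N).map (· ∘ g) = iterUltrafilter M := by
  induction N generalizing M with
  | zero =>
    cases M with
    | zero =>
      rw [show (fun f : Fin 0 → ℕ => f ∘ g) = id from funext fun f => Subsingleton.elim _ _]
      exact Ultrafilter.map_id _
    | succ M => exact (g 0).elim0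
  | succ N ih =>
    by_cases h0 : ∀ j, g j ≠ 0
    · have hmono : StrictMono fun j => (g j).pred (h0 j) := fun i j hij => by
        simpa using hg hij
      ext s
      rw [Ultrafilter.mem_map, mem_iterUltrafilter_succ, ← ih _ hmono, Ultrafilter.mem_map]
      have : ∀ (k : ℕ) (f : Fin N → ℕ),
          (Fin.cons k f : Fin (N + 1) → ℕ) ∘ g = f ∘ fun j => (g j).pred (h0 j) := by
        intro k f
        funext j
        exact cons_eq_apply_pred k f (h0 j)
      simp only [Set.mem_preimage, this]
      exact Filter.eventually_const
    · push Not at h0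
      obtain ⟨j, hj⟩ := h0
      cases M with
      | zero => exact j.elim0
      | succ M =>
        have hg0 : g 0 = 0 := le_antisymm (hj ▸ hg.monotone (Fin.zero_le j)) (Fin.zero_le _)
        have hne : ∀ i : Fin M, g i.succ ≠ 0 := fun i h =>
          absurd (hg (Fin.succ_pos i)) (by rw [hg0, h]; exact lt_irrefl _)
        have hmono : StrictMono fun i : Fin M => (g i.succ).pred (hne i) := fun i j hij => by
          simpa using hg (Fin.succ_lt_succ_iff.2 hij)
        ext s
        rw [Ultrafilter.mem_map, mem_iterUltrafilter_succ, mem_iterUltrafilter_succ]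
        refine Filter.eventually_congr (Eventually.of_forall fun k => ?_)
        rw [← ih _ hmono, Ultrafilter.mem_map]
        have : ∀ f : Fin N → ℕ, (Fin.cons k f : Fin (N + 1) → ℕ) ∘ g =
            (Fin.cons k (f ∘ fun i : Fin M => (g i.succ).pred (hne i)) : Fin (M + 1) → ℕ) := by
          intro f
          funext i
          refine Fin.cases ?_ (fun i => ?_) i
          · simp [hg0]
          · exact cons_eq_apply_pred k f (hne i)
        simp only [Set.mem_preimage, this]
        rfl

/-- For each linear order `X`, the ultrafilters `iterUltrafilter N` have a common extension to
maps `X → ℕ`. -/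
theorem exists_ultrafilter_map_eq_iterUltrafilter (X : Type*) [LinearOrder X] :
    ∃ V : Ultrafilter (X → ℕ), ∀ (N : ℕ) (s : Fin N ↪o X),
      V.map (· ∘ s) = iterUltrafilter N := by
  classical
  let G : (Σ N, Fin N ↪o X) → Filter (X → ℕ) := fun s =>
    comap (· ∘ s.2) (iterUltrafilter s.1)
  have hne : ∀ s, (G s).NeBot := fun s =>
    NeBot.comap_of_surj (iterUltrafilter s.1).neBot
      (Function.Injective.surjective_comp_right s.2.injective)
  have hle : ∀ s t : (Σ N, Fin N ↪o X), Set.range s.2 ⊆ Set.range t.2 → G t ≤ G s := by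
    rintro ⟨M, s⟩ ⟨N, t⟩ hst
    choose g hg using fun i : Fin M => hst ⟨i, rfl⟩
    have hmono : StrictMono g := fun i j hij => by
      rw [← t.lt_iff_lt, hg, hg]
      exact s.strictMono hij
    have hs : (fun f : X → ℕ => f ∘ s) = (fun f => f ∘ g) ∘ fun f => f ∘ t := by
      funext f i
      simp only [Function.comp]
      rw [hg]
    simp only [G]
    rw [hs, ← comap_comap, ← map_iterUltrafilter g hmono]
    exact comap_mono le_comap_map
  have hdir : Directed (· ≥ ·) G := by
    intro s t
    let F : Finset X := Finset.univ.image s.2 ∪ Finset.univ.image t.2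
    refine ⟨⟨F.card, F.orderEmbOfFin rfl⟩, hle _ _ ?_, hle _ _ ?_⟩
    all_goals
      rw [Finset.range_orderEmbOfFin]
      simp [F]
  have : Nonempty (Σ N, Fin N ↪o X) := ⟨⟨0, OrderEmbedding.ofIsEmpty⟩⟩
  have := iInf_neBot_of_directed' hdir hne
  refine ⟨Ultrafilter.of (⨅ s, G s), fun N s => ?_⟩
  rw [← Ultrafilter.coe_le_coe, Ultrafilter.coe_map, map_le_iff_le_comap]
  exact (Ultrafilter.of_le _).trans (iInf_le G ⟨N, s⟩)

variable {L : FirstOrder.Language.{u, v}} {C : Type w} [L.Structure C] {κ : Cardinal.{w}}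

/-- From each sequence `J` one obtains, along each small linear order, a `B`-indiscernible sequence
satisfying all formulas over `B` which hold along all increasing subfamilies of `J`. -/
theorem IsSaturated.exists_indiscernible (hC : IsSaturated L C κ) (hκ : ℵ₀ ≤ κ) {B : Set C}
    (hB : #B < κ) {X : Type x} [LinearOrder X] {τ : Type y}
    (hX : Cardinal.lift.{w} #(X × τ) < Cardinal.lift.{max x y} κ) (J : ℕ → τ → C) :
    ∃ a : X → τ → C, Indiscernible L B a ∧
      ∀ (N : ℕ) (s : Fin N ↪o X) (ψ : L.Formula (B ⊕ (Fin N × τ))),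
        (∀ t : Fin N ↪o ℕ, ψ.Realize (Sum.elim (↑) fun j => J (t j.1) j.2)) →
          ψ.Realize (Sum.elim (↑) fun j => a (s j.1) j.2) := by
  obtain ⟨V, hV⟩ := exists_ultrafilter_map_eq_iterUltrafilter X
  obtain ⟨d, hd⟩ := hC.exists_isLimit hκ (e := ((↑) : B → C)) (by simpa using hB) hX
    (V.map fun f (z : X × τ) => J (f z.1) z.2)
  have key : ∀ (N : ℕ) (s : Fin N ↪o X) (ψ : L.Formula (B ⊕ (Fin N × τ))),
      ψ.Realize (Sum.elim (↑) fun j => d (s j.1, j.2)) ↔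
        ∀ᶠ t in (iterUltrafilter N : Filter (Fin N → ℕ)),
          ψ.Realize (Sum.elim (↑) fun j => J (t j.1) j.2) := by
    intro N s ψ
    obtain ⟨r, f, ψ', hψ'⟩ := exists_fin_formula (C := C) ψ
    have := hd r (fun i => (s (f i).1, (f i).2)) (fun _ => Set.mem_univ _) ψ'
    rw [hψ', ← hV N s]
    simp only [hψ', Ultrafilter.coe_map, eventually_map] at this ⊢
    exact this
  refine ⟨fun x t => d (x, t), ?_, fun N s ψ h => ?_⟩
  · rw [indiscernible_iff]
    intro m s t ψ
    rw [key, key]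
  · rw [key]
    refine Filter.mem_of_superset (strictMono_mem_iterUltrafilter N 0) ?_
    rintro t ⟨ht, -⟩
    exact h (OrderEmbedding.ofStrictMono t ht)

end EhrenfeuchtMostowski

/-! ### Mutually indiscernible sequences -/

section MutualIndiscernibility

variable {L : FirstOrder.Language.{u, v}} {C : Type w} [L.Structure C] {B : Set C}

/-- In a mutually indiscernible family, the type of a subfamily only depends on the order pattern
inside each of the sequences. The subfamilies are changed in one sequence at a time. -/
theorem MutuallyIndiscernible.sameTypeOver {K : Type*} {ι : K → Type*} [∀ k, LinearOrder (ι k)]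
    {τ : K → Type*} {I : ∀ k, ι k → τ k → C} (h : MutuallyIndiscernible L B I) {Z : K → Type*}
    {f g : ∀ k, Z k → ι k} (hfg : ∀ k z z', f k z < f k z' ↔ g k z < g k z') :
    SameTypeOver L B (fun q : Σ k, Z k × τ k => I q.1 (f q.1 q.2.1) q.2.2)
      (fun q => I q.1 (g q.1 q.2.1) q.2.2) := by
  classical
  have key : ∀ S : Finset K, SameTypeOver L B
      (fun q : Σ k, Z k × τ k => I q.1 (f q.1 q.2.1) q.2.2)
      (fun q => I q.1 (if q.1 ∈ S then g q.1 q.2.1 else f q.1 q.2.1) q.2.2) := by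
    intro S
    induction S using Finset.induction_on with
    | empty => exact SameType.refl _
    | insert k S hk ih =>
      refine ih.trans (((h k).sameTypeOver (hfg k)).subst (fun b hb => Or.inl (Or.inl hb)) ?_)
      rintro ⟨k', z, t⟩
      by_cases hkk : k' = k
      · subst hkk
        exact Or.inr ⟨(z, t), by simp [hk], by simp⟩
      · refine Or.inl ⟨Or.inr ?_, by simp [hkk]⟩
        exact Set.mem_biUnion (show k' ∈ {j | j ≠ k} from hkk) ⟨_, _, rfl⟩
  refine SameTypeOver.of_finset fun F => ⟨_, key (F.image Sigma.fst), fun q hq => ?_⟩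
  simp [Finset.mem_image_of_mem Sigma.fst hq]

/-- The converse of `MutuallyIndiscernible.sameTypeOver`, for sequences with a common index order:
finite subfamilies suffice. -/
theorem mutuallyIndiscernible_of_sameTypeOver {K : Type*} {ι : Type*} [LinearOrder ι]
    {τ : Type*} {I : K → ι → τ → C}
    (h : ∀ (r : ℕ) (k : Fin r → K) (f g : Fin r → ι) (t : Fin r → τ),
      (∀ z z', k z = k z' → (f z < f z' ↔ g z < g z')) →
        SameTypeOver L B (fun z => I (k z) (f z) (t z)) (fun z => I (k z) (g z) (t z))) :
    MutuallyIndiscernible L B I := by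
  intro k
  rw [indiscernible_iff]
  intro m s t
  let O : Set C := ⋃ j ∈ {j : K | j ≠ k}, entries (I j)
  have hO : ∀ b : O, ∃ (j : K) (i : ι) (t : τ), j ≠ k ∧ I j i t = b := by
    rintro ⟨b, hb⟩
    simp only [O, Set.mem_iUnion] at hb
    obtain ⟨j, hj, i, t, hit⟩ := hb
    exact ⟨j, i, t, hj, hit⟩
  choose kAt iAt tAt hkAt hIAt using hO
  let kk : (Fin m × τ) ⊕ O → K := Sum.elim (fun _ => k) kAt
  let f : (Fin m × τ) ⊕ O → ι := Sum.elim (fun z => s z.1) iAt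
  let g : (Fin m × τ) ⊕ O → ι := Sum.elim (fun z => t z.1) iAt
  let tt : (Fin m × τ) ⊕ O → τ := Sum.elim (fun z => z.2) tAt
  have hpat : ∀ z z', kk z = kk z' → (f z < f z' ↔ g z < g z') := by
    rintro (z | z) (z' | z') hz
    · simp [f, g]
    · exact absurd hz.symm (hkAt z')
    · exact absurd hz (hkAt z)
    · rfl
  have key : SameTypeOver L B (fun z => I (kk z) (f z) (tt z)) (fun z => I (kk z) (g z) (tt z)) :=
    SameTypeOver.of_fin fun r q => h r (kk ∘ q) (f ∘ q) (g ∘ q) (tt ∘ q) fun z z' => hpat _ _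
  refine key.subst ?_ fun z => Or.inr ⟨Sum.inl z, rfl, rfl⟩
  rintro b (hb | hb)
  · exact Or.inl hb
  · exact Or.inr ⟨Sum.inr ⟨b, hb⟩, hIAt _, hIAt _⟩

/-- Consecutive blocks of an indiscernible sequence are mutually indiscernible. -/
theorem Indiscernible.mutuallyIndiscernible_blocks {K : Type*} [LinearOrder K] {ι : Type*}
    [LinearOrder ι] {τ : Type*} {a : K ×ₗ ι → τ → C} (h : Indiscernible L B a) :
    MutuallyIndiscernible L B fun k i => a (toLex (k, i)) := by
  refine mutuallyIndiscernible_of_sameTypeOver fun r k f g t hfg => ?_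
  refine (h.sameTypeOver (f := fun z => toLex (k z, f z)) (g := fun z => toLex (k z, g z))
    ?_).comp fun z => (z, t z)
  intro z z'
  simp only [Prod.Lex.toLex_lt_toLex]
  exact or_congr_right (and_congr_right fun hz => hfg z z' hz)

theorem MutuallyIndiscernible.comp {K K' : Type*} {ι : K → Type*} [∀ k, LinearOrder (ι k)]
    {τ : K → Type*} {I : ∀ k, ι k → τ k → C} (h : MutuallyIndiscernible L B I) {g : K' → K}
    (hg : Function.Injective g) : MutuallyIndiscernible L B fun k => I (g k) := by
  refine fun k => (h (g k)).mono (Set.union_subset_union_right _ ?_)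
  exact Set.iUnion₂_subset fun j hj =>
    Set.subset_biUnion_of_mem (u := fun j => entries (I j))
      (show g j ∈ {j' | j' ≠ g k} from fun h' => hj (hg h'))

/-- Along a sequence which is indiscernible over a tuple `d`, a formula with parameters `d` has
constant truth value. -/
theorem Indiscernible.realize_iff {ι : Type*} [LinearOrder ι] {τ σ : Type*} {a : ι → τ → C}
    {d : σ → C} (h : Indiscernible L (B ∪ Set.range d) a) (φ : L.Formula (σ ⊕ τ)) (i j : ι) :
    φ.Realize (Sum.elim d (a i)) ↔ φ.Realize (Sum.elim d (a j)) := by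
  have h1 : SameTypeOver L ∅ (Sum.elim d (a i)) (Sum.elim d (a j)) := by
    refine (h.sameTypeOver (Z := Unit) (f := fun _ => i) (g := fun _ => j) (by simp)).subst
      (by simp) ?_
    rintro (s | t)
    · exact Or.inl ⟨Or.inr ⟨s, rfl⟩, rfl⟩
    · exact Or.inr ⟨((), t), rfl, rfl⟩
  exact SameType.comp h1 Sum.inr φ

end MutualIndiscernibility

/-! ### The independence property -/

section Shattering

variable {L : FirstOrder.Language.{u, v}} {C : Type w} [L.Structure C]

variable (L) in
/-- The set `D` of `σ`-tuples is the set of realizations of a partial type over `A`. -/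
def IsTypeDefinable (A : Set C) {σ : Type*} (D : Set (σ → C)) : Prop :=
  ∃ P : Set (L.Formula (A ⊕ σ)), D = {d | ∀ ψ ∈ P, ψ.Realize (Sum.elim ((↑) : A → C) d)}

theorem isTypeDefinable_univ (A : Set C) {σ : Type*} :
    IsTypeDefinable L A (Set.univ : Set (σ → C)) :=
  ⟨∅, by simp⟩

theorem isTypeDefinable_realizes {A : Set C} {n : ℕ} (p : Set (L[[A]].Formula (Fin n))) :
    IsTypeDefinable L A {d | Realizes p d} := by
  refine ⟨(fun φ => Language.BoundedFormula.constantsVarsEquiv φ) '' p, ?_⟩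
  ext d
  simp only [Set.mem_ofPred_eq, Set.forall_mem_image]
  refine forall₂_congr fun φ _ => ?_
  exact (Language.BoundedFormula.realize_constantsVarsEquiv (φ := φ) (v := d)).symm

theorem IsTypeDefinable.mono {A B : Set C} {σ : Type*} {D : Set (σ → C)}
    (hD : IsTypeDefinable L A D) (hAB : A ⊆ B) : IsTypeDefinable L B D := by
  obtain ⟨P, rfl⟩ := hD
  refine ⟨(fun ψ => ψ.relabel (Sum.map (Set.inclusion hAB) id)) '' P, ?_⟩
  ext d
  simp only [Set.mem_ofPred_eq, Set.forall_mem_image, Language.Formula.realize_relabel,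
    Sum.elim_comp_map]
  rfl

/-- The set of `m`-tuples of elements of `D`. -/
def tuplesIn {σ : Type*} (D : Set (σ → C)) (m : ℕ) : Set (Fin m × σ → C) :=
  {d | ∀ j, (fun s => d (j, s)) ∈ D}

theorem IsTypeDefinable.tuplesIn {A : Set C} {σ : Type*} {D : Set (σ → C)}
    (hD : IsTypeDefinable L A D) (m : ℕ) : IsTypeDefinable L A (tuplesIn D m) := by
  obtain ⟨P, rfl⟩ := hD
  refine ⟨{χ | ∃ ψ ∈ P, ∃ j : Fin m, χ = ψ.relabel (Sum.map id fun s => (j, s))}, ?_⟩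
  have key : ∀ (ψ : L.Formula (A ⊕ σ)) (j : Fin m) (d : Fin m × σ → C),
      (ψ.relabel (Sum.map id fun s => (j, s)) : L.Formula (A ⊕ (Fin m × σ))).Realize
        (Sum.elim (↑) d) ↔ ψ.Realize (Sum.elim (↑) fun s => d (j, s)) := by
    intro ψ j d
    rw [Language.Formula.realize_relabel, Sum.elim_comp_map]
    rfl
  ext d
  constructor
  · rintro h _ ⟨ψ, hψ, j, rfl⟩
    exact (key ψ j d).2 (h j ψ hψ)
  · exact fun h j ψ hψ => (key ψ j d).1 (h _ ⟨ψ, hψ, j, rfl⟩)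

/-- The formula `φ` and the tuples in `D` cut out all subsets of the family `b`. -/
def Shatters {σ τ X : Type*} (φ : L.Formula (σ ⊕ τ)) (D : Set (σ → C)) (b : X → τ → C) : Prop :=
  ∀ S : Set X, ∃ d ∈ D, ∀ i, φ.Realize (Sum.elim d (b i)) ↔ i ∈ S

/-- The formula `φ` and the tuples in `D` cut out all finite subsets of the sequence `b`. -/
def ShattersFinite {σ τ : Type*} (φ : L.Formula (σ ⊕ τ)) (D : Set (σ → C)) (b : ℕ → τ → C) :
    Prop :=
  ∀ S : Finset ℕ, ∃ d ∈ D, ∀ i, φ.Realize (Sum.elim d (b i)) ↔ i ∈ S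

variable (L) in
/-- The independence property for tuples in `D`. Only formulas without parameters are considered,
since parameters can be appended to the tuples `b i`; hence this notion does not refer to a base
set. -/
def HasIP {σ : Type*} (D : Set (σ → C)) : Prop :=
  ∃ (τ : Type) (_ : Finite τ) (φ : L.Formula (σ ⊕ τ)) (b : ℕ → τ → C), ShattersFinite φ D b

theorem Shatters.shattersFinite {σ τ : Type*} {φ : L.Formula (σ ⊕ τ)} {D : Set (σ → C)}
    {b : ℕ → τ → C} (h : Shatters φ D b) : ShattersFinite φ D b :=
  fun S => by simpa using h S

/-- Exchanging the roles of the two groups of variables: if the sequence `b` is indexed by the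
finite subsets of `ℕ`, then tuples `a j` which cut out `{S | j ∈ S}` are shattered by the tuples
`b S`. -/
theorem Shatters.exists_swap {σ τ : Type*} {φ : L.Formula (σ ⊕ τ)} {D : Set (σ → C)}
    {E : Set (τ → C)} {b : ℕ → τ → C} (h : Shatters φ D b) (hb : ∀ k, b k ∈ E) :
    ∃ a : ℕ → σ → C, (∀ j, a j ∈ D) ∧ ShattersFinite (φ.relabel Sum.swap) E a := by
  let e : Finset ℕ ≃ ℕ := Denumerable.eqv _
  choose a ha hφ using fun j => h {k | j ∈ e.symm k}
  refine ⟨a, ha, fun S => ⟨b (e S), hb _, fun j => ?_⟩⟩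
  have := hφ j (e S)
  have hs : Sum.elim (b (e S)) (a j) ∘ Sum.swap = Sum.elim (a j) (b (e S)) := by
    funext z; rcases z with z | z <;> rfl
  rw [Language.Formula.realize_relabel, hs, this]
  simp

variable {κ : Cardinal.{w}} {A : Set C}

theorem mk_union_range_lt (hκ : ℵ₀ ≤ κ) {B : Set C} (hB : #B < κ) {σ : Type x}
    (hσ : Cardinal.lift.{w} #σ < Cardinal.lift.{x} κ) (d : σ → C) :
    #(↑(B ∪ Set.range d) : Type w) < κ := by
  refine (mk_union_le _ _).trans_lt (add_lt_of_lt hκ hB ?_)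
  rw [← Cardinal.lift_lt.{w, x}]
  exact mk_range_le_lift.trans_lt hσ

theorem lift_mk_lt_of_countable (hκ : ℵ₀ < κ) (σ : Type x) [Countable σ] :
    Cardinal.lift.{w} #σ < Cardinal.lift.{x} κ :=
  (lift_le_aleph0.2 (mk_le_aleph0 (α := σ))).trans_lt (aleph0_lt_lift.2 hκ)

/-- A finitely shattered sequence can be replaced by an indiscernible one along any small linear
order, all of whose subsets are cut out by tuples in `D`. -/
theorem ShattersFinite.exists_indiscernible (hC : IsSaturated L C κ) (hκ : ℵ₀ < κ) (hA : #A < κ)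
    {σ : Type} {τ : Type} [Finite σ] [Finite τ] {D : Set (σ → C)} (hD : IsTypeDefinable L A D)
    {φ : L.Formula (σ ⊕ τ)} {b : ℕ → τ → C} (hb : ShattersFinite φ D b)
    {X : Type x} [LinearOrder X] (hX : Cardinal.lift.{w} #X < Cardinal.lift.{x} κ) :
    ∃ b' : X → τ → C, Indiscernible L A b' ∧
      (∀ ψ : L.Formula (A ⊕ τ), (∀ i, ψ.Realize (Sum.elim (↑) (b i))) →
        ∀ i, ψ.Realize (Sum.elim (↑) (b' i))) ∧ Shatters φ D b' := by
  classical
  have hX' : Cardinal.lift.{w} #(X × τ) < Cardinal.lift.{x} κ := by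
    rw [mk_prod, Cardinal.lift_mul]
    refine mul_lt_of_lt (aleph0_le_lift.2 hκ.le) (by simpa using hX) ?_
    simp only [lift_lift]
    refine lt_of_lt_of_le ?_ (aleph0_le_lift.2 hκ.le)
    rw [lift_lt_aleph0]
    exact mk_lt_aleph0
  obtain ⟨b', h1, h2⟩ := hC.exists_indiscernible hκ.le hA hX' b
  refine ⟨b', h1, fun ψ hψ i => ?_, fun S => ?_⟩
  · have := h2 1 (OrderEmbedding.ofStrictMono (fun _ => i) (Subsingleton.strictMono _))
      (ψ.relabel (Sum.map id fun t => (0, t)))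
    simp only [Language.Formula.realize_relabel, Sum.elim_comp_map] at this
    exact this fun t => hψ (t 0)
  obtain ⟨P, rfl⟩ := hD
  -- The formulas to be satisfied by a tuple cutting out `S ∩ s` along a subfamily `s`.
  let q {Y : Type x} (s : Y → X) : P ⊕ Y → L.Formula ((A ⊕ (Y × τ)) ⊕ σ) := Sum.elim
    (fun ψ => ψ.1.relabel (Sum.map Sum.inl id))
    fun i => if s i ∈ S then φ.relabel (Sum.elim Sum.inr fun t => Sum.inl (Sum.inr (i, t)))
      else (φ.relabel (Sum.elim Sum.inr fun t => Sum.inl (Sum.inr (i, t)))).not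
  have hq1 : ∀ {Y : Type x} (s : Y → X) (ψ : P) (c : Y × τ → C) (d : σ → C),
      (q s (Sum.inl ψ)).Realize (Sum.elim (Sum.elim (↑) c) d) ↔
        ψ.1.Realize (Sum.elim (↑) d) := by
    intro Y s ψ c d
    simp only [q, Sum.elim_inl, Language.Formula.realize_relabel]
    exact iff_of_eq (congrArg _ (by funext z; rcases z with z | z <;> rfl))
  have hq2 : ∀ {Y : Type x} (s : Y → X) (i : Y) (c : Y × τ → C) (d : σ → C),
      (q s (Sum.inr i)).Realize (Sum.elim (Sum.elim (↑) c) d) ↔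
        (φ.Realize (Sum.elim d fun t => c (i, t)) ↔ s i ∈ S) := by
    intro Y s i c d
    have h3 : Sum.elim (Sum.elim ((↑) : A → C) c) d ∘
        Sum.elim Sum.inr (fun t => Sum.inl (Sum.inr (i, t))) = Sum.elim d fun t => c (i, t) := by
      funext z; rcases z with z | z <;> rfl
    by_cases hi : s i ∈ S <;>
      simp [q, hi, Language.Formula.realize_relabel, Language.Formula.realize_not, h3]
  have hsmall : #(Set.range (Sum.elim ((↑) : A → C) fun z : X × τ => b' z.1 z.2)) < κ := by
    rw [Set.Sum.elim_range, Subtype.range_coe]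
    exact mk_union_range_lt hκ.le hA hX' _
  obtain ⟨d, hd⟩ := hC.exists_realize hκ.le hsmall (σ := σ) (lift_mk_lt_of_countable hκ _)
    (Γ := Set.range (q id)) (by
      intro Γ₀ hΓ₀
      rw [← Set.image_univ] at hΓ₀
      obtain ⟨I₀, -, rfl⟩ := Finset.subset_set_image_iff.1 hΓ₀
      let F : Finset X := I₀.toRight
      let s : ULift.{x} (Fin F.card) → X := fun i => F.orderEmbOfFin rfl i.down
      obtain ⟨θ, hθ⟩ := exists_formula_exists (C := C) (α := A ⊕ (ULift.{x} (Fin F.card) × τ))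
        (σ := σ) (Γ := q s '' ↑(I₀.toLeft.map Function.Embedding.inl ∪
          Finset.univ.map Function.Embedding.inr : Finset (P ⊕ ULift.{x} (Fin F.card))))
          ((Finset.finite_toSet _).image _)
      have h4 := h2 F.card (F.orderEmbOfFin rfl)
        (θ.relabel (Sum.map id fun z => (z.1.down, z.2)))
      simp only [Language.Formula.realize_relabel, Sum.elim_comp_map] at h4
      have h5 := h4 (by
        intro t
        refine (hθ _).2 ?_
        obtain ⟨d, hd, hdt⟩ := hb (Finset.univ.image t |>.filter fun j =>
          ∃ i, t i = j ∧ F.orderEmbOfFin rfl i ∈ S)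
        refine ⟨d, ?_⟩
        rintro _ ⟨ψ | i, hi, rfl⟩
        · exact (hq1 s ψ _ d).2 (hd _ ψ.2)
        · refine (hq2 s i _ d).2 ?_
          refine (hdt (t i.down)).trans ?_
          simp [s])
      obtain ⟨d, hd⟩ := (hθ _).1 h5
      refine ⟨d, fun ψ hψ => ?_⟩
      obtain ⟨ψ | i, hi, rfl⟩ := Finset.mem_image.1 hψ
      · have := hd _ ⟨Sum.inl ψ, by simpa using hi, rfl⟩
        exact (hq1 id ψ _ d).2 ((hq1 s ψ _ d).1 this)
      · have hiF : i ∈ F := by simpa [F] using hi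
        obtain ⟨j, hj⟩ : ∃ j, F.orderEmbOfFin rfl j = i := by
          have : i ∈ Set.range (F.orderEmbOfFin rfl) := by
            rw [Finset.range_orderEmbOfFin]; exact hiF
          exact this
        have := (hq2 s ⟨j⟩ _ d).1 (hd _ ⟨Sum.inr ⟨j⟩, by simp, rfl⟩)
        simp only [s, Function.comp, hj] at this
        exact (hq2 id i _ d).2 this)
  refine ⟨d, fun ψ hψ => ?_, fun i => ?_⟩
  · exact (hq1 id ⟨ψ, hψ⟩ _ d).1 (hd _ ⟨Sum.inl ⟨ψ, hψ⟩, rfl⟩)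
  · exact (hq2 id i _ d).1 (hd _ ⟨Sum.inr i, rfl⟩)

/-- If a formula with parameters `d ∈ D` distinguishes `u k` from `w k` for all `k`, while replacing
`u k` by `w k` for any set of indices `k` does not change the type of the sequence over `A`, then
the copies of `d` given by homogeneity shatter the sequence `u`. -/
theorem shatters_of_sameTypeOver (hC : IsSaturated L C κ) (hκ : ℵ₀ < κ) (hA : #A < κ)
    {σ : Type} {τ : Type} [Finite σ] [Finite τ] {D : Set (σ → C)} (hD : IsTypeDefinable L A D)
    {ψ : L.Formula (σ ⊕ τ)} {d : σ → C} (hd : d ∈ D) {u w : ℕ → τ → C}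
    (hu : ∀ k, ψ.Realize (Sum.elim d (u k))) (hw : ∀ k, ¬ ψ.Realize (Sum.elim d (w k)))
    (h : ∀ s : ℕ → τ → C, (∀ k, s k = u k ∨ s k = w k) →
      SameTypeOver L A (fun z : ℕ × τ => s z.1 z.2) (fun z => u z.1 z.2)) :
    Shatters ψ D u := by
  classical
  intro S
  obtain ⟨d', hd'⟩ := hC.exists_sameType hκ.le (by
    rw [Set.Sum.elim_range, Subtype.range_coe]
    exact mk_union_range_lt hκ.le hA (lift_mk_lt_of_countable hκ _) _)
    (h (fun k => if k ∈ S then u k else w k) fun k => by by_cases hk : k ∈ S <;> simp [hk]) d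
  refine ⟨d', ?_, fun k => ?_⟩
  · obtain ⟨P, rfl⟩ := hD
    intro χ hχ
    have := (hd' (χ.relabel (Sum.map Sum.inl id)))
    simp only [Language.Formula.realize_relabel, Sum.elim_comp_map, Sum.elim_comp_inl] at this
    exact this.1 (hd χ hχ)
  · have := hd' (ψ.relabel (Sum.elim Sum.inr fun t => Sum.inl (Sum.inr (k, t))))
    have h3 : ∀ (c : ℕ × τ → C) (d : σ → C), Sum.elim (Sum.elim ((↑) : A → C) c) d ∘
        Sum.elim Sum.inr (fun t => Sum.inl (Sum.inr (k, t))) = Sum.elim d fun t => c (k, t) := by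
      intro c d
      funext z; rcases z with z | z <;> rfl
    simp only [Language.Formula.realize_relabel, h3] at this
    by_cases hk : k ∈ S
    · simp only [hk, iff_true, if_true] at this ⊢
      exact this.1 (hu k)
    · simp only [hk, iff_false, if_false] at this ⊢
      exact fun h' => hw k (this.2 h')

end Shattering

/-! ### The cardinal `|T|⁺ + |A|⁺` -/

section Cardinals

theorem mk_sigma_le_of_forall_le {f : ℕ → Type x} {ν : Cardinal.{x}} (hν : ℵ₀ ≤ ν)
    (h : ∀ i, #(f i) ≤ ν) : #(Σ i, f i) ≤ ν := by
  rw [mk_sigma]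
  refine (sum_le_sum _ _ h).trans ?_
  rw [sum_const, mk_nat, lift_aleph0, lift_id']
  exact (mul_le_max_of_aleph0_le_left le_rfl).trans (max_le hν le_rfl)

theorem mk_fun_fin_le {Y : Type x} {ν : Cardinal.{x}} (hν : ℵ₀ ≤ ν) (h : #Y ≤ ν) (r : ℕ) :
    #(Fin r → Y) ≤ ν := by
  have : #(Fin r → Y) = #Y ^ r := by simp
  rw [this]
  exact (pow_le_pow_left' h r).trans (power_nat_le hν)

variable (L : FirstOrder.Language.{u, v}) {C : Type w}

/-- The cardinal `|T| + |A|`. -/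
noncomputable def baseCard (A : Set C) : Cardinal.{max u v w} :=
  Cardinal.lift.{w} (cardT L) + Cardinal.lift.{max u v} #A

theorem aleph0_le_cardT : ℵ₀ ≤ cardT L := le_add_self

theorem aleph0_le_baseCard (A : Set C) : ℵ₀ ≤ baseCard L A :=
  (aleph0_le_lift.2 (aleph0_le_cardT L)).trans le_self_add

theorem shrinkingLength_eq_succ (A : Set C) :
    shrinkingLength L A = Order.succ (baseCard L A) := by
  have h1 : ℵ₀ ≤ Cardinal.lift.{w} (cardT L) := aleph0_le_lift.2 (aleph0_le_cardT L)
  have h2 : ℵ₀ ≤ Cardinal.lift.{w} (Order.succ (cardT L)) :=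
    aleph0_le_lift.2 ((aleph0_le_cardT L).trans (Order.le_succ _))
  rw [shrinkingLength, baseCard, add_eq_max h1, add_eq_max h2, lift_succ, lift_succ,
    (Order.succ_mono).map_max]

variable {L}

theorem mk_formula_le {α : Type} [Countable α] : #(L.Formula α) ≤ cardT L := by
  have h1 : #(L.Formula α) ≤ #(Σ n, L.BoundedFormula α n) :=
    mk_le_of_injective (f := fun φ => ⟨0, φ⟩) fun φ ψ h => by simpa using h
  refine (h1.trans Language.BoundedFormula.card_le).trans (max_le (aleph0_le_cardT L) ?_)
  rw [lift_uzero, add_comm]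
  exact add_le_add_right (lift_le_aleph0.2 mk_le_aleph0) _

theorem lift_mk_formula_le {α : Type} [Countable α] {A : Set C} :
    Cardinal.lift.{w} #(L.Formula α) ≤ baseCard L A :=
  (lift_le.2 mk_formula_le).trans le_self_add

/-- The number of formulas over `B` in finitely many of the variables of finitely many
`τ`-tuples. -/
theorem mk_codes_le {A B : Set C} (hB : Cardinal.lift.{max u v} #B ≤ baseCard L A)
    (ρ τ : Type) [Finite ρ] [Finite τ] :
    #(Σ m : ℕ, Σ r : ℕ, (Fin r → B ⊕ (Fin m × τ)) × L.Formula (ρ ⊕ Fin r)) ≤ baseCard L A := by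
  have hν := aleph0_le_baseCard L A
  refine mk_sigma_le_of_forall_le hν fun m => mk_sigma_le_of_forall_le hν fun r => ?_
  rw [mk_prod]
  refine (mul_le_mul' ?_ lift_mk_formula_le).trans (mul_eq_self hν).le
  rw [← mk_uLift]
  refine (mk_congr (Equiv.ulift.trans (Equiv.arrowCongr (Equiv.refl _)
    (Equiv.ulift.{max u v} (α := B ⊕ (Fin m × τ))).symm))).le.trans
      (mk_fun_fin_le hν ?_ r)
  rw [mk_uLift, mk_sum, lift_add, lift_lift]
  refine (add_le_add ?_ ?_).trans (add_eq_self hν).le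
  · simpa using hB
  · exact (lift_le_aleph0.2 (lift_le_aleph0.2 mk_le_aleph0)).trans hν

theorem lift_mk_union_finite_le {A B : Set C} (hB : (B \ A).Finite) :
    Cardinal.lift.{max u v} #B ≤ baseCard L A := by
  have hν := aleph0_le_baseCard L A
  have h1 : #B ≤ #A + ℵ₀ := by
    refine (mk_le_mk_of_subset (t := A ∪ (B \ A)) (by simp)).trans ((mk_union_le _ _).trans ?_)
    exact add_le_add_right hB.lt_aleph0.le _
  refine (lift_le.2 h1).trans ?_
  rw [lift_add, lift_aleph0]
  exact (add_le_add le_add_self hν).trans (add_eq_self hν).le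

/-- A map to a smaller type is constant on an infinite set. -/
theorem exists_injective_nat_fiber {K : Type x} {Q : Type y} [Infinite K] (f : K → Q)
    (h : Cardinal.lift.{x} #Q < Cardinal.lift.{y} #K) :
    ∃ (q : Q) (e : ℕ → K), Function.Injective e ∧ ∀ i, f (e i) = q := by
  obtain ⟨q, hq⟩ := exists_infinite_fiber (β := ULift.{y} K) (α := ULift.{x} Q)
    (fun k => ⟨f k.down⟩) (by simpa using h)
  let e := Infinite.natEmbedding ((fun k : ULift.{y} K => (⟨f k.down⟩ : ULift.{x} Q)) ⁻¹' {q})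
  exact ⟨q.down, fun i => (e i).1.down,
    fun i j hij => e.injective (Subtype.ext (ULift.ext _ _ hij)),
    fun i => congrArg ULift.down (e i).2⟩

variable (L)

/-- By regularity, a family of at most `|T| + |A|` indices is bounded. -/
theorem exists_forall_le_ord_toType (A : Set C) {Y : Type (max u v w)} (hY : #Y ≤ baseCard L A)
    (g : Y → (shrinkingLength L A).ord.ToType) : ∃ α, ∀ y, g y ≤ α := by
  have hreg : (shrinkingLength L A).IsRegular := by
    rw [shrinkingLength_eq_succ]
    exact isRegular_succ (aleph0_le_baseCard L A)
  have : ¬ IsCofinal (Set.range g) := by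
    intro h
    have h1 := (Order.cof_le h).trans (mk_range_le.trans hY)
    rw [Ordinal.cof_toType, hreg.cof_ord, shrinkingLength_eq_succ, Order.succ_le_iff] at h1
    exact absurd h1 (lt_irrefl _)
  obtain ⟨α, hα⟩ := not_isCofinal_iff.1 this
  exact ⟨α, fun y => (hα _ ⟨y, rfl⟩).le⟩

theorem aleph0_le_shrinkingLength (A : Set C) : ℵ₀ ≤ shrinkingLength L A := by
  rw [shrinkingLength_eq_succ]
  exact (aleph0_le_baseCard L A).trans (Order.le_succ _)

theorem mk_Iic_lt (A : Set C) (α : (shrinkingLength L A).ord.ToType) :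
    #(Set.Iic α) < shrinkingLength L A := by
  have hinf := aleph0_le_shrinkingLength L A
  have h3 : #(Set.Iio α) < shrinkingLength L A := by
    have := mk_Iio_lt α (by rw [mk_ord_toType, Ordinal.type_toType])
    rwa [mk_ord_toType] at this
  rw [← Set.Iio_insert]
  exact mk_insert_le.trans_lt (add_lt_of_lt hinf h3 (one_lt_aleph0.trans_le hinf))

theorem nonempty_ord_toType (A : Set C) : Nonempty (shrinkingLength L A).ord.ToType := by
  rw [← mk_ne_zero_iff, mk_ord_toType]
  exact (aleph0_pos.trans_le (aleph0_le_shrinkingLength L A)).ne'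

/-- A set of indices which alternates with its complement beyond each index. -/
theorem exists_alternating_set (A : Set C) :
    ∃ S : Set (shrinkingLength L A).ord.ToType,
      ∀ α, (∃ i, α < i ∧ i ∈ S) ∧ ∃ i, α < i ∧ i ∉ S := by
  set X := (shrinkingLength L A).ord.ToType
  have hX : #X = shrinkingLength L A := mk_ord_toType _
  have hinf := aleph0_le_shrinkingLength L A
  obtain ⟨e⟩ : Nonempty (X × Bool ≃ X) := by
    rw [← Cardinal.eq, mk_prod, lift_id', mk_bool, hX]
    simpa using mul_eq_left hinf (by exact (natCast_lt_aleph0 (n := 2)).le.trans hinf) two_ne_zero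
  have key : ∀ (b : Bool) (α : X), ∃ i, α < i ∧ (e.symm i).2 = b := by
    intro b α
    by_contra! h
    have h1 : ∀ x : X, e (x, b) ∈ Set.Iic α := fun x =>
      not_lt.1 fun hx => h _ hx (by simp)
    have h2 : #X ≤ #(Set.Iic α) :=
      mk_le_of_injective (f := fun x => ⟨e (x, b), h1 x⟩) fun x y hxy => by simpa using hxy
    have h4 : #(Set.Iic α) < #X := (mk_Iic_lt L A α).trans_eq hX.symm
    exact absurd h2 h4.not_ge
  exact ⟨{i | (e.symm i).2 = true}, fun α => ⟨key true α, by simpa using key false α⟩⟩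

/-- The end segments of `λ`, for the infinite cardinal `λ = |T|⁺ + |A|⁺`, are isomorphic to `λ`. -/
theorem nonempty_orderIso_Ioi (A : Set C) (α : (shrinkingLength L A).ord.ToType) :
    Nonempty ((shrinkingLength L A).ord.ToType ≃o Set.Ioi α) := by
  have hX := mk_ord_toType (shrinkingLength L A)
  have h4 : #(Set.Ioi α) = shrinkingLength L A := by
    have : Infinite (shrinkingLength L A).ord.ToType := by
      rw [Cardinal.infinite_iff, hX]
      exact aleph0_le_shrinkingLength L A
    rw [← Set.compl_Iic, mk_compl_of_infinite _ ((mk_Iic_lt L A α).trans_eq hX.symm), hX]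
  have h6 : Ordinal.type (α := (shrinkingLength L A).ord.ToType) (· < ·) =
      Ordinal.type (α := Set.Ioi α) (· < ·) := by
    apply le_antisymm
    · rw [Ordinal.type_toType, Cardinal.ord_le, Ordinal.card_type, h4]
    · exact Ordinal.type_le_iff'.2 ⟨(OrderEmbedding.subtype _).ltEmbedding⟩
  exact (Ordinal.type_eq.1 h6).map OrderIso.ofRelIsoLT

variable {L} {κ : Cardinal.{w}} {A : Set C}

theorem aleph0_lt_of_shrinkingLength_lt
    (hlen : shrinkingLength L A < Cardinal.lift.{max u v} κ) : ℵ₀ < κ := by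
  rw [← aleph0_lt_lift.{w, max u v}]
  refine lt_of_le_of_lt (aleph0_le_baseCard L A) (lt_of_le_of_lt (Order.le_succ _) ?_)
  rwa [← shrinkingLength_eq_succ]

theorem mk_lt_of_shrinkingLength_lt
    (hlen : shrinkingLength L A < Cardinal.lift.{max u v} κ) : #A < κ := by
  rw [← Cardinal.lift_lt.{w, max u v}]
  refine lt_of_le_of_lt (?_ : _ ≤ baseCard L A) (lt_of_le_of_lt (Order.le_succ _) ?_)
  · exact le_add_self
  · rwa [← shrinkingLength_eq_succ]

theorem lift_mk_ord_toType_lt (hlen : shrinkingLength L A < Cardinal.lift.{max u v} κ) :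
    Cardinal.lift.{w} #(shrinkingLength L A).ord.ToType < Cardinal.lift.{max u v w} κ := by
  rw [mk_ord_toType, Cardinal.lift_id'.{w, max u v}]
  exact hlen.trans_eq (Cardinal.lift_umax.{w, max u v} ▸ rfl)

end Cardinals

/-! ### Dependence and the independence property -/

section Dependence

variable {L : FirstOrder.Language.{u, v}} {C : Type w} [L.Structure C] {κ : Cardinal.{w}}
  {A B : Set C}

theorem Indiscernible.reindex {ι : Type*} [LinearOrder ι] {τ τ' : Type*} {a : ι → τ → C}
    (h : Indiscernible L B a) (g : τ' → τ) : Indiscernible L B fun i t => a i (g t) := by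
  rw [indiscernible_iff] at h ⊢
  exact fun m s t => (h m s t).comp fun j : Fin m × τ' => (j.1, g j.2)

/-- Mutually indiscernible sequences none of which remains indiscernible over a tuple in `D`, for
a uniform reason `ψ`, yield the independence property. -/
theorem MutuallyIndiscernible.hasIP (hC : IsSaturated L C κ) (hκ : ℵ₀ < κ) (hA : #A < κ)
    {σ : Type} [Finite σ] {D : Set (σ → C)} (hD : IsTypeDefinable L A D) {d : σ → C} (hd : d ∈ D)
    (hAB : A ⊆ B) {ι : ℕ → Type*} [∀ k, LinearOrder (ι k)] {τ : ℕ → Type*}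
    {I : ∀ k, ι k → τ k → C} (hI : MutuallyIndiscernible L B I) {r : ℕ} {ψ : L.Formula (σ ⊕ Fin r)}
    {m : ℕ → ℕ} {s t : ∀ k, Fin (m k) ↪o ι k} {f : ∀ k, Fin r → B ⊕ (Fin (m k) × τ k)}
    (hs : ∀ k, ψ.Realize (Sum.elim d (Sum.elim (↑) (fun j => I k (s k j.1) j.2) ∘ f k)))
    (ht : ∀ k, ¬ ψ.Realize (Sum.elim d (Sum.elim (↑) (fun j => I k (t k j.1) j.2) ∘ f k))) :
    HasIP L D := by
  classical
  refine ⟨Fin r, inferInstance, ψ, _,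
    (shatters_of_sameTypeOver hC hκ hA hD hd hs ht fun c hc => ?_).shattersFinite⟩
  let q : ∀ k, Fin (m k) → ι k := fun k j =>
    if c k = Sum.elim (↑) (fun j => I k (s k j.1) j.2) ∘ f k then s k j else t k j
  have hq : ∀ k, c k = Sum.elim (↑) (fun j => I k (q k j.1) j.2) ∘ f k := by
    intro k
    by_cases h : c k = Sum.elim (↑) (fun j => I k (s k j.1) j.2) ∘ f k
    · simp only [q, h, if_true]
    · simp only [q, h, if_false]
      exact (hc k).resolve_left h
  have key := hI.sameTypeOver (Z := fun k => Fin (m k)) (f := q) (g := fun k => s k) (by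
    intro k z z'
    by_cases h : c k = Sum.elim (↑) (fun j => I k (s k j.1) j.2) ∘ f k <;> simp [q, h])
  refine key.subst (fun a ha => Or.inl (hAB ha)) ?_
  rintro ⟨k, i⟩
  simp only [hq k, Function.comp]
  rcases hf : f k i with b | ⟨j, t'⟩
  · exact Or.inl ⟨b.2, rfl⟩
  · exact Or.inr ⟨⟨k, j, t'⟩, rfl, rfl⟩

theorem isDependent_of_not_hasIP (hC : IsSaturated L C κ)
    (hlen : shrinkingLength L A < Cardinal.lift.{max u v} κ) {n : ℕ}
    {p : Set (L[[A]].Formula (Fin n))} (h : ¬ HasIP L {d | Realizes p d}) : IsDependent κ p := by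
  classical
  have hκ := aleph0_lt_of_shrinkingLength_lt hlen
  have hA := mk_lt_of_shrinkingLength_lt hlen
  have h1 : Cardinal.lift.{w} (Order.succ (cardT L)) < Cardinal.lift.{max u v} κ :=
    lt_of_le_of_lt le_self_add hlen
  -- The bound is `|T|⁺`, brought down to the universe of `C`.
  obtain ⟨μ, hμ⟩ := mem_range_lift_of_le h1.le
  refine ⟨μ, by rwa [← hμ, lift_lt] at h1, ?_⟩
  intro d hd K hK ι _ _ τ I hI
  by_contra! hn
  have hwit : ∀ k, ∃ (r : ℕ) (ψ : L.Formula (Fin n ⊕ Fin r)) (m : ℕ) (s t : Fin m ↪o ι k)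
      (f : Fin r → A ⊕ (Fin m × τ k)),
      ψ.Realize (Sum.elim d (Sum.elim (↑) (fun j => I k (s j.1) j.2) ∘ f)) ∧
      ¬ ψ.Realize (Sum.elim d (Sum.elim (↑) (fun j => I k (t j.1) j.2) ∘ f)) := by
    intro k
    have := hn k
    rw [indiscernible_iff] at this
    push Not at this
    obtain ⟨m, s, t, hst⟩ := this
    obtain ⟨r, f, ψ, h1, h2⟩ := exists_formula_of_not_sameTypeOver hst
    exact ⟨r, ψ, m, s, t, f, h1, h2⟩
  choose r ψ m s t f hs ht using hwit
  have hKcard : Cardinal.lift.{max u v} #K = Cardinal.lift.{w} (Order.succ (cardT L)) := by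
    rw [hK, hμ]
  have hKinf : Infinite K := by
    rw [Cardinal.infinite_iff, ← aleph0_le_lift.{w, max u v}, hKcard, aleph0_le_lift]
    exact (aleph0_le_cardT L).trans (Order.le_succ _)
  obtain ⟨⟨r₀, ψ₀⟩, e, he, hfib⟩ := exists_injective_nat_fiber
    (fun k => (⟨r k, ψ k⟩ : Σ r, L.Formula (Fin n ⊕ Fin r))) (by
      rw [hKcard, lift_lt, Order.lt_succ_iff]
      exact mk_sigma_le_of_forall_le (aleph0_le_cardT L) fun r => mk_formula_le)
  -- The lengths `r (e i)` are equal, but not definitionally, so the witnesses are transported.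
  have hr : ∀ i, ∃ f' : Fin r₀ → A ⊕ (Fin (m (e i)) × τ (e i)),
      ψ₀.Realize (Sum.elim d (Sum.elim (↑) (fun j => I (e i) (s (e i) j.1) j.2) ∘ f')) ∧
      ¬ ψ₀.Realize (Sum.elim d (Sum.elim (↑) (fun j => I (e i) (t (e i) j.1) j.2) ∘ f')) := by
    intro i
    have h1 := hs (e i)
    have h2 := ht (e i)
    have h3 := hfib i
    generalize f (e i) = f' at h1 h2
    generalize ψ (e i) = ψ' at h1 h2 h3
    generalize r (e i) = r' at f' ψ' h1 h2 h3
    cases h3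
    exact ⟨f', h1, h2⟩
  choose f' hs' ht' using hr
  exact h ((hI.comp he).hasIP hC hκ hA (isTypeDefinable_realizes p) hd subset_rfl hs' ht')

theorem not_isDependent_of_hasIP (hC : IsSaturated L C κ)
    (hlen : shrinkingLength L A < Cardinal.lift.{max u v} κ) {n : ℕ}
    {p : Set (L[[A]].Formula (Fin n))} (h : HasIP L {d | Realizes p d}) : ¬ IsDependent κ p := by
  have hκ := aleph0_lt_of_shrinkingLength_lt hlen
  have hA := mk_lt_of_shrinkingLength_lt hlen
  classical
  rintro ⟨μ, hμ, hrk⟩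
  obtain ⟨τ, _, φ, b, hb⟩ := h
  let K : Type w := μ.out
  let _ : LinearOrder K := linearOrderOfSTO WellOrderingRel
  have hX : #(K ×ₗ ULift.{w} ℕ) < κ := by
    rw [mk_congr (toLex (α := K × ULift.{w} ℕ)).symm, mk_prod]
    simpa [K] using mul_lt_of_lt hκ.le hμ hκ
  obtain ⟨b', hb', -, hsh⟩ := hb.exists_indiscernible hC hκ hA (isTypeDefinable_realizes p)
    (X := K ×ₗ ULift.{w} ℕ) (by simpa using hX)
  -- A single `d` separates the first element from the others in each of the blocks.
  obtain ⟨d, hd, hφ⟩ := hsh {i | (ofLex i).2.down = 0}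
  obtain ⟨k, hk⟩ := hrk d hd K (mk_out μ) (fun _ => ULift.{w} ℕ) (fun _ => ULift.{w} τ)
    (fun k i t => b' (toLex (k, i)) t.down)
    (hb'.reindex (ULift.down : ULift.{w} τ → τ)).mutuallyIndiscernible_blocks
  have h1 := (hk.reindex (ULift.up : τ → ULift.{w} τ)).realize_iff φ ⟨0⟩ ⟨1⟩
  rw [hφ, hφ] at h1
  simp at h1

theorem IsOneIndependentOver.hasIP (hC : IsSaturated L C κ)
    (hlen : shrinkingLength L A < Cardinal.lift.{max u v} κ) {n : ℕ}
    {p : Set (L[[A]].Formula (Fin n))} (hAB : A ⊆ B) (h : IsOneIndependentOver p B) :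
    HasIP L {d | Realizes p d} := by
  obtain ⟨d, hd, ι, _, _, I, hI, hind, hn⟩ := h
  have h0 := hn 0
  rw [indiscernible_iff] at h0
  push Not at h0
  obtain ⟨m, s, t, hst⟩ := h0
  obtain ⟨r, f, ψ, h1, h2⟩ := exists_formula_of_not_sameTypeOver hst
  -- By indiscernibility of the sequence of the `I k`, one formula works for all `k`.
  have key : ∀ (k : ℕ) (s : Fin m ↪o ι),
      ψ.Realize (Sum.elim d (Sum.elim (↑) (fun j : Fin m × Unit => I k (s j.1)) ∘ f)) ↔
      ψ.Realize (Sum.elim d (Sum.elim (↑) (fun j : Fin m × Unit => I 0 (s j.1)) ∘ f)) := by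
    intro k s
    have h3 : SameTypeOver L ∅
        (Sum.elim d (Sum.elim (↑) (fun j : Fin m × Unit => I k (s j.1)) ∘ f))
        (Sum.elim d (Sum.elim (↑) (fun j : Fin m × Unit => I 0 (s j.1)) ∘ f)) := by
      refine (hind.sameTypeOver (Z := Unit) (f := fun _ => k) (g := fun _ => 0) (by simp)).subst
        (by simp) ?_
      rintro (i | i)
      · exact Or.inl ⟨Or.inr ⟨i, rfl⟩, rfl⟩
      · simp only [Sum.elim_inr, Function.comp]
        rcases f i with b | ⟨j, t'⟩
        · exact Or.inl ⟨Or.inl b.2, rfl⟩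
        · exact Or.inr ⟨((), s j), rfl, rfl⟩
    exact SameType.comp h3 Sum.inr ψ
  exact hI.hasIP hC (aleph0_lt_of_shrinkingLength_lt hlen) (mk_lt_of_shrinkingLength_lt hlen)
    (isTypeDefinable_realizes p) hd hAB (m := fun _ => m) (s := fun _ => s) (t := fun _ => t)
    (f := fun _ => f) (fun k => (key k s).2 h1) (fun k h => h2 ((key k t).1 h))

end Dependence

/-! ### Shrinking of indiscernibles -/

section Shrinking

variable {L : FirstOrder.Language.{u, v}} {C : Type w} [L.Structure C] {κ : Cardinal.{w}}
  {A B : Set C}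

/-- Families lying in consecutive intervals of a linear order are ordered lexicographically. -/
theorem lt_iff_of_blocks {X : Type*} [LinearOrder X] {m : ℕ} {e : ℕ → X} (he : Monotone e)
    {q : ℕ → Fin m → X} (hq : ∀ k, StrictMono (q k)) (h1 : ∀ k j, e k < q k j)
    (h2 : ∀ k j, q k j ≤ e (k + 1)) (z z' : ℕ × Fin m) :
    q z.1 z.2 < q z'.1 z'.2 ↔ z.1 < z'.1 ∨ z.1 = z'.1 ∧ z.2 < z'.2 := by
  have key : ∀ {k k' : ℕ} (j j'), k < k' → q k j < q k' j' := fun j j' hk =>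
    ((h2 _ j).trans (he hk)).trans_lt (h1 _ j')
  obtain ⟨k, j⟩ := z
  obtain ⟨k', j'⟩ := z'
  rcases lt_trichotomy k k' with h | rfl | h
  · simp [h, key j j' h]
  · simp [(hq k).lt_iff_lt]
  · simp [h.not_gt, h.ne', (key j' j h).le]

/-- If an indiscernible sequence of length `|T|⁺ + |A|⁺` has no end segment which is indiscernible
over `c ∈ D`, then by regularity a single formula is responsible for this. Its truth value changes
infinitely often along consecutive blocks, so that the copies of `c` given by homogeneity shatter
a sequence of blocks. -/
theorem exists_shatters_of_not_indiscernible (hC : IsSaturated L C κ)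
    (hlen : shrinkingLength L A < Cardinal.lift.{max u v} κ) (hAB : A ⊆ B)
    (hB : Cardinal.lift.{max u v} #B ≤ baseCard L A) {ρ τ : Type} [Finite ρ] [Finite τ]
    {D : Set (ρ → C)} (hD : IsTypeDefinable L A D) {c : ρ → C} (hc : c ∈ D)
    {a : (shrinkingLength L A).ord.ToType → τ → C} {α₀ : (shrinkingLength L A).ord.ToType}
    (h : Indiscernible L B fun i : Set.Ioi α₀ => a i)
    (hn : ∀ α, α₀ ≤ α → ¬ Indiscernible L (B ∪ Set.range c) fun i : Set.Ioi α => a i) :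
    ∃ (m r : ℕ) (f : Fin r → B ⊕ (Fin m × τ)) (ψ : L.Formula (ρ ⊕ Fin r))
      (s : ℕ → Fin m → (shrinkingLength L A).ord.ToType),
      Shatters ψ D fun k => Sum.elim ((↑) : B → C) (fun j => a (s k j.1) j.2) ∘ f := by
  classical
  let X := (shrinkingLength L A).ord.ToType
  let Q := Σ m : ℕ, Σ r : ℕ, (Fin r → B ⊕ (Fin m × τ)) × L.Formula (ρ ⊕ Fin r)
  let R : (q : Q) → (Fin q.1 → X) → Prop := fun q s =>
    q.2.2.2.Realize (Sum.elim c (Sum.elim (↑) (fun j => a (s j.1) j.2) ∘ q.2.2.1))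
  -- A formula which is not constant beyond any index: otherwise, each formula would become constant
  -- at some index, and all of them at a common one.
  obtain ⟨q, hq⟩ : ∃ q : Q, ∀ α, α₀ ≤ α → ∃ s t : Fin q.1 → X, StrictMono s ∧ StrictMono t ∧
      (∀ j, α < s j) ∧ (∀ j, α < t j) ∧ R q s ∧ ¬ R q t := by
    by_contra! hcon
    choose g hg hgn using hcon
    obtain ⟨α, hα⟩ := exists_forall_le_ord_toType L A (mk_codes_le hB ρ τ) g
    have h1 := hn (max α α₀) (le_max_right _ _)
    rw [indiscernible_iff] at h1
    push Not at h1
    obtain ⟨m, s, t, hst⟩ := h1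
    obtain ⟨r, f, ψ, h1, h2⟩ := exists_formula_of_not_sameTypeOver hst
    have hlt : ∀ i : Set.Ioi (max α α₀), g ⟨m, r, f, ψ⟩ < i :=
      fun i => ((hα _).trans (le_max_left _ _)).trans_lt i.2
    exact h2 (hgn ⟨m, r, f, ψ⟩ (fun j => s j) (fun j => t j) (fun i j hij => s.strictMono hij)
      (fun i j hij => t.strictMono hij) (fun j => hlt _) (fun j => hlt _) h1)
  obtain ⟨m, r, f, ψ⟩ := q
  have _ : Nonempty X := ⟨α₀⟩
  choose S T hS hT hSα hTα hRS hRT using hq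
  -- Beyond each index `α`, the next one `β` leaves room for the two subfamilies between
  -- `α` and `β`.
  have hnext : ∀ α : Set.Ici α₀, ∃ β : Set.Ici α₀, α ≤ β ∧
      (∀ j, S α α.2 j ≤ β) ∧ ∀ j, T α α.2 j ≤ β := by
    intro α
    obtain ⟨β₁, h1⟩ := Finite.exists_le (S α α.2)
    obtain ⟨β₂, h2⟩ := Finite.exists_le (T α α.2)
    exact ⟨⟨max α.1 (max β₁ β₂), (show α₀ ≤ α.1 from α.2).trans (le_max_left _ _)⟩,
      le_max_left (α := X) _ _,
      fun j => (h1 j).trans ((le_max_left _ _).trans (le_max_right _ _)),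
      fun j => (h2 j).trans ((le_max_right _ _).trans (le_max_right _ _))⟩
  choose next hle hSn hTn using hnext
  let e : ℕ → Set.Ici α₀ := fun k => next^[k] ⟨α₀, Set.self_mem_Ici⟩
  have he : ∀ k, e (k + 1) = next (e k) := fun k => Function.iterate_succ_apply' _ _ _
  have hmono : Monotone e := monotone_nat_of_le_succ fun k => by rw [he]; exact hle _
  refine ⟨m, r, f, ψ, fun k => S (e k) (e k).2, ?_⟩
  refine shatters_of_sameTypeOver hC (aleph0_lt_of_shrinkingLength_lt hlen)
    (mk_lt_of_shrinkingLength_lt hlen) hD hc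
    (w := fun k => Sum.elim (↑) (fun j => a (T (e k) (e k).2 j.1) j.2) ∘ f)
    (fun k => hRS _ _) (fun k => hRT _ _) fun c' hc' => ?_
  let q : ℕ → Fin m → X := fun k =>
    if c' k = Sum.elim (↑) (fun j => a (S (e k) (e k).2 j.1) j.2) ∘ f then S (e k) (e k).2
    else T (e k) (e k).2
  have hq : ∀ k, c' k = Sum.elim (↑) (fun j => a (q k j.1) j.2) ∘ f ∧ StrictMono (q k) ∧
      (∀ j, (e k : X) < q k j) ∧ ∀ j, q k j ≤ e (k + 1) := by
    intro k
    by_cases h : c' k = Sum.elim (↑) (fun j => a (S (e k) (e k).2 j.1) j.2) ∘ f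
    · simp only [q, h, if_true, he]
      exact ⟨trivial, hS _ _, hSα _ _, hSn _⟩
    · simp only [q, h, if_false, he]
      exact ⟨(hc' k).resolve_left h, hT _ _, hTα _ _, hTn _⟩
  have key := h.sameTypeOver (Z := ℕ × Fin m)
    (f := fun z => ⟨q z.1 z.2, (e z.1).2.trans_lt ((hq z.1).2.2.1 z.2)⟩)
    (g := fun z => ⟨S (e z.1) (e z.1).2 z.2, (e z.1).2.trans_lt (hSα _ (e z.1).2 z.2)⟩) (by
      intro z z'
      have hmono' : Monotone fun k => (e k : X) := fun i j hij => hmono hij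
      refine (lt_iff_of_blocks hmono' (fun k => (hq k).2.1) (fun k => (hq k).2.2.1)
        (fun k => (hq k).2.2.2) z z').trans (lt_iff_of_blocks (q := fun k => S (e k) (e k).2)
          hmono' (fun k => hS _ _) (fun k => hSα _ _) (fun k => ?_) z z').symm
      rw [he]
      exact hSn _)
  refine key.subst (fun a ha => Or.inl (hAB ha)) ?_
  rintro ⟨k, i⟩
  simp only [(hq k).1, Function.comp]
  rcases f i with b | ⟨j, t'⟩
  · exact Or.inl ⟨b.2, rfl⟩
  · exact Or.inr ⟨⟨⟨k, j⟩, t'⟩, rfl, rfl⟩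

/-- The independence property for tuples of elements of `D` reduces to `D` itself. A long
indiscernible sequence along which a formula with parameters `d₁, …, dₘ` alternates
cannot have end segments which are indiscernible over `d₁, …, dₘ`, so this must fail at one of the
steps of adding the `dᵢ` one by one. -/
theorem hasIP_of_hasIP_tuplesIn (hC : IsSaturated L C κ)
    (hlen : shrinkingLength L A < Cardinal.lift.{max u v} κ) {σ : Type} [Finite σ]
    {D : Set (σ → C)} (hD : IsTypeDefinable L A D) {m : ℕ} (h : HasIP L (tuplesIn D m)) :
    HasIP L D := by
  classical
  by_contra hcon
  obtain ⟨τ, _, φ, b, hb⟩ := h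
  have hX := lift_mk_ord_toType_lt hlen
  obtain ⟨a, ha, -, hsh⟩ := hb.exists_indiscernible hC (aleph0_lt_of_shrinkingLength_lt hlen)
    (mk_lt_of_shrinkingLength_lt hlen) (hD.tuplesIn m) hX
  obtain ⟨S, hS⟩ := exists_alternating_set L A
  obtain ⟨d, hd, hφ⟩ := hsh S
  have key : ∀ F : Finset (Fin m), ∃ α : (shrinkingLength L A).ord.ToType, Indiscernible L
      (A ∪ ⋃ j ∈ F, Set.range fun s => d (j, s)) fun i : Set.Ioi α => a i := by
    intro F
    induction F using Finset.induction_on with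
    | empty =>
      obtain ⟨α, -⟩ := (hS (nonempty_ord_toType L A).some).1
      exact ⟨α, by simpa using ha.comp (OrderEmbedding.subtype (· ∈ Set.Ioi α))⟩
    | insert j F hj ih =>
      obtain ⟨α₀, hα₀⟩ := ih
      by_contra! hn
      have hfin : ((A ∪ ⋃ j ∈ F, Set.range fun s => d (j, s)) \ A).Finite :=
        (F.finite_toSet.biUnion fun j _ => Set.finite_range fun s => d (j, s)).subset (by
          rw [Set.union_sdiff_left]
          exact Set.sdiff_subset)
      obtain ⟨m', r, f, ψ, s, hs⟩ := exists_shatters_of_not_indiscernible hC hlen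
        Set.subset_union_left (lift_mk_union_finite_le hfin) hD (hd j) hα₀ (fun α _ hα => by
          refine hn α (hα.mono ?_)
          rw [Finset.set_biUnion_insert, Set.union_comm (Set.range _), ← Set.union_assoc])
      exact hcon ⟨_, inferInstance, ψ, _, hs.shattersFinite⟩
  obtain ⟨α, hα⟩ := key Finset.univ
  have hα' : Indiscernible L (A ∪ Set.range d) fun i : Set.Ioi α => a i := by
    refine hα.mono (Set.union_subset_union_right _ ?_)
    rintro _ ⟨⟨j, s⟩, rfl⟩
    exact Set.mem_biUnion (Finset.mem_coe.2 (Finset.mem_univ j)) ⟨s, rfl⟩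
  obtain ⟨⟨i, hi, hiS⟩, i', hi', hiS'⟩ := hS α
  have := hα'.realize_iff φ ⟨i, hi⟩ ⟨i', hi'⟩
  exact hiS' ((hφ i').1 (this.1 ((hφ i).2 hiS)))

/-- If shrinking over the singleton `c` fails for a sequence in `D`, then tuples of elements of `D`
shatter a sequence of singletons, by means of a formula with a finite tuple of parameters `e`. -/
theorem exists_shattersFinite_singletons (hC : IsSaturated L C κ)
    (hlen : shrinkingLength L A < Cardinal.lift.{max u v} κ) {A' : Set C} (hA' : A ⊆ A')
    (hfin : (A' \ A).Finite) {σ : Type} [Finite σ] {D : Set (σ → C)}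
    {a : (shrinkingLength L A).ord.ToType → σ → C} (haD : ∀ i, a i ∈ D)
    (ha : Indiscernible L A' a) {c : C}
    (hn : ∀ α : (shrinkingLength L A).ord.ToType,
      ¬ Indiscernible L (A' ∪ {c}) fun i : Set.Ioi α => a i) :
    ∃ (m r : ℕ) (φ : L.Formula ((Fin m × σ) ⊕ (Unit ⊕ Fin r))) (e : Fin r → C) (c' : ℕ → C),
      ShattersFinite φ (tuplesIn D m) fun k => Sum.elim (fun _ => c' k) e := by
  obtain ⟨α₀⟩ := nonempty_ord_toType L A
  obtain ⟨m, r, f, ψ, s, hs⟩ := exists_shatters_of_not_indiscernible hC hlen hA'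
    (lift_mk_union_finite_le hfin) (isTypeDefinable_univ A) (Set.mem_univ fun _ : Unit => c)
    (ha.comp (OrderEmbedding.subtype (· ∈ Set.Ioi α₀))) (fun α _ => by simpa using hn α)
  -- The places of `ψ` filled by parameters in `A'` become variables, to be filled by `e`.
  let g : Unit ⊕ Fin r → (Fin m × σ) ⊕ (Unit ⊕ Fin r) := Sum.elim (fun _ => Sum.inr (Sum.inl ()))
    fun i => Sum.elim (fun _ => Sum.inr (Sum.inr i)) Sum.inl (f i)
  let e : Fin r → C := fun i => Sum.elim (↑) (fun _ => c) (f i)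
  have hg : ∀ (c' : Unit → C) (d : Fin m × σ → C),
      Sum.elim d (Sum.elim c' e) ∘ g = Sum.elim c' (Sum.elim (↑) d ∘ f) := by
    intro c' d
    funext z
    rcases z with z | i
    · rfl
    · simp only [g, Function.comp, Sum.elim_inr]
      rcases hf : f i with b | t <;> simp [e, hf]
  -- The blocks are indexed by the finite subsets of `ℕ`, as in `Shatters.exists_swap`.
  let enc : Finset ℕ ≃ ℕ := Denumerable.eqv _
  choose c' _ hc' using fun j => hs {k | j ∈ enc.symm k}
  refine ⟨m, r, ψ.relabel g, e, fun j => c' j (), fun S =>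
    ⟨fun z => a (s (enc S) z.1) z.2, fun j => haD (s (enc S) j), fun j => ?_⟩⟩
  rw [Language.Formula.realize_relabel, hg]
  refine (hc' j (enc S)).trans ?_
  simp

theorem singletonShrinking_of_not_hasIP (hC : IsSaturated L C κ)
    (hlen : shrinkingLength L A < Cardinal.lift.{max u v} κ) {n : ℕ}
    {p : Set (L[[A]].Formula (Fin n))} (h : ¬ HasIP L {d | Realizes p d}) :
    SingletonShrinking p := by
  intro A' hA' hfin a hap ha c
  by_contra! hn
  obtain ⟨m, r, φ, e, c', hsh⟩ := exists_shattersFinite_singletons hC hlen hA' hfin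
    (D := {d | Realizes p d}) hap ha hn
  exact h (hasIP_of_hasIP_tuplesIn hC hlen (isTypeDefinable_realizes p)
    ⟨_, inferInstance, φ, _, hsh⟩)

/-- The independence property yields a tuple `c` and a long indiscernible sequence of realizations
along which a formula with parameters `c` alternates, so that shrinking fails for one of the entries
of `c`. -/
theorem not_singletonShrinking_of_hasIP (hC : IsSaturated L C κ)
    (hlen : shrinkingLength L A < Cardinal.lift.{max u v} κ) {n : ℕ}
    {p : Set (L[[A]].Formula (Fin n))} (h : HasIP L {d | Realizes p d}) :
    ¬ SingletonShrinking p := by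
  classical
  intro hshr
  have hκ := aleph0_lt_of_shrinkingLength_lt hlen
  have hA := mk_lt_of_shrinkingLength_lt hlen
  obtain ⟨τ, _, φ, b, hb⟩ := h
  obtain ⟨b₁, -, -, hb₁⟩ := hb.exists_indiscernible hC hκ hA (isTypeDefinable_realizes p)
    (X := ℕ) (lift_mk_lt_of_countable hκ _)
  obtain ⟨a₀, ha₀p, ha₀⟩ := hb₁.exists_swap (E := Set.univ) fun _ => Set.mem_univ _
  have hX := lift_mk_ord_toType_lt hlen
  obtain ⟨a, ha, hEM, hsh⟩ := ha₀.exists_indiscernible hC hκ hA (isTypeDefinable_univ A) hX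
  have hap : ∀ i, Realizes p (a i) := by
    obtain ⟨P, hP⟩ := isTypeDefinable_realizes p
    intro i
    have h1 : a i ∈ {d | Realizes p d} := by
      rw [hP]
      exact fun ψ hψ => hEM ψ (fun k => (hP ▸ ha₀p k :) ψ hψ) i
    exact h1
  obtain ⟨S, hS⟩ := exists_alternating_set L A
  obtain ⟨c, -, hc⟩ := hsh S
  have := Fintype.ofFinite τ
  have key : ∀ F : Finset τ, ∃ α : (shrinkingLength L A).ord.ToType,
      Indiscernible L (A ∪ c '' F) fun i : Set.Ioi α => a i := by
    intro F
    induction F using Finset.induction_on with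
    | empty =>
      obtain ⟨α, -⟩ := (hS (nonempty_ord_toType L A).some).1
      exact ⟨α, by simpa using ha.comp (OrderEmbedding.subtype (· ∈ Set.Ioi α))⟩
    | insert t F ht ih =>
      obtain ⟨α, hα⟩ := ih
      obtain ⟨g⟩ := nonempty_orderIso_Ioi L A α
      have hfin : ((A ∪ c '' F) \ A).Finite := (F.finite_toSet.image c).subset (by
        rw [Set.union_sdiff_left]
        exact Set.sdiff_subset)
      obtain ⟨β, hβ⟩ := hshr (A ∪ c '' F) Set.subset_union_left hfin (fun i => a (g i))
        (fun i => hap _) (hα.comp g.toOrderEmbedding) (c t)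
      refine ⟨g β, ?_⟩
      have hlt : ∀ i : Set.Ioi (g β : (shrinkingLength L A).ord.ToType), α < i :=
        fun i => lt_trans (g β).2 i.2
      let g' : Set.Ioi (g β : (shrinkingLength L A).ord.ToType) ↪o Set.Ioi β :=
        OrderEmbedding.ofStrictMono
          (fun i => ⟨g.symm ⟨i, hlt i⟩, by
            rw [Set.mem_Ioi, ← g.lt_iff_lt, OrderIso.apply_symm_apply]
            exact i.2⟩)
          (fun i j hij => g.symm.strictMono (a := ⟨i, hlt i⟩) (b := ⟨j, hlt j⟩) hij)
      have h1 := (hβ.comp g').mono (B' := A ∪ c '' ↑(insert t F)) (by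
        rw [Finset.coe_insert, Set.image_insert_eq, ← Set.union_singleton, Set.union_assoc])
      have h2 : (fun i => a (g (g' i))) =
          fun i : Set.Ioi (g β : (shrinkingLength L A).ord.ToType) => a i := by
        funext i
        change a (g (g.symm ⟨i, hlt i⟩)) = a i
        rw [OrderIso.apply_symm_apply]
      rwa [h2] at h1
  obtain ⟨α, hα⟩ := key Finset.univ
  rw [Finset.coe_univ, Set.image_univ] at hα
  obtain ⟨⟨i, hi, hiS⟩, i', hi', hiS'⟩ := hS α
  have := hα.realize_iff (φ.relabel Sum.swap) ⟨i, hi⟩ ⟨i', hi'⟩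
  exact hiS' ((hc i').1 (this.1 ((hc i).2 hiS)))

end Shrinking

/-! ### Witnesses consisting of singletons -/

section OneIndependence

variable {L : FirstOrder.Language.{u, v}} {C : Type w} [L.Structure C] {κ : Cardinal.{w}}
  {A B E : Set C}

/-- If `I` is mutually indiscernible over `B`, but not over `E`, then there are a
finite set `G` of entries and a copy of `ℚ` inside `ℚ` along which all the sequences fail to be
indiscernible over `E ∪ G`, while mutual indiscernibility holds over `B ∪ G`: if the failure at
`I k` is due to the entries `G` of finitely many other sequences, then by indiscernibility over `E`
the same failure occurs at `I k'`, for `k'` close to `k`. -/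
theorem exists_finite_of_not_mutuallyIndiscernible {ι : Type w} [LinearOrder ι] {I : ℚ → ι → C}
    (hI : MutuallyIndiscernible L B fun k i (_ : Unit) => I k i)
    (hind : Indiscernible L E I)
    (hn : ¬ MutuallyIndiscernible L E fun k i (_ : Unit) => I k i) :
    ∃ (G : Set C) (h : ℚ ↪o ℚ), G.Finite ∧
      (MutuallyIndiscernible L (B ∪ G) fun k i (_ : Unit) => I (h k) i) ∧
      (Indiscernible L (E ∪ G) fun k => I (h k)) ∧
      ∀ k, ¬ Indiscernible L (E ∪ G) fun i (_ : Unit) => I (h k) i := by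
  classical
  simp only [MutuallyIndiscernible, not_forall] at hn
  obtain ⟨k₀, hk₀⟩ := hn
  rw [indiscernible_iff] at hk₀
  push Not at hk₀
  obtain ⟨m, s, t, hst⟩ := hk₀
  obtain ⟨G, hGO, hGfin, hG⟩ := exists_finite_not_sameTypeOver hst
  have hGex : ∀ g : G, ∃ (q : ℚ) (i : ι), q ≠ k₀ ∧ I q i = g := by
    rintro ⟨g, hg⟩
    have := hGO hg
    simp only [Set.mem_iUnion] at this
    obtain ⟨q, hq, i, _, hi⟩ := this
    exact ⟨q, i, hq, hi⟩
  choose q i hqk hqi using hGex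
  have := hGfin.to_subtype
  obtain ⟨l, u, hk₀lu, hlu⟩ := mem_nhds_iff_exists_Ioo_subset.1
    ((Set.finite_range q).isClosed.isOpen_compl.mem_nhds
      (show k₀ ∈ (Set.range q)ᶜ from fun ⟨g, hg⟩ => hqk g hg))
  have hlu' : l < u := hk₀lu.1.trans hk₀lu.2
  have : Nontrivial (Set.Ioo l u) := by
    obtain ⟨c, hc⟩ := exists_between hk₀lu.1
    exact ⟨⟨⟨k₀, hk₀lu⟩, ⟨c, hc.1, hc.2.trans hk₀lu.2⟩, fun h => hc.2.ne' (congrArg Subtype.val h)⟩⟩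
  obtain ⟨h₀⟩ := Order.embedding_from_countable_to_dense ℚ (Set.Ioo l u)
  let h : ℚ ↪o ℚ := h₀.trans (OrderEmbedding.subtype _)
  have hh : ∀ k, h k ∈ Set.Ioo l u := fun k => (h₀ k).2
  have hlq : ∀ g, q g ≤ l ∨ u ≤ q g := by
    intro g
    by_contra! hcon
    exact hlu hcon ⟨g, rfl⟩
  have hqlt : ∀ g, ∀ x ∈ Set.Ioo l u, ∀ y ∈ Set.Ioo l u, (q g < x ↔ q g < y) := by
    intro g x hx y hy
    rcases hlq g with h | h
    · exact iff_of_true (h.trans_lt hx.1) (h.trans_lt hy.1)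
    · exact iff_of_false (hx.2.trans_le h).not_gt (hy.2.trans_le h).not_gt
  have hltq : ∀ g, ∀ x ∈ Set.Ioo l u, ∀ y ∈ Set.Ioo l u, (x < q g ↔ y < q g) := by
    intro g x hx y hy
    rcases hlq g with h | h
    · exact iff_of_false (h.trans_lt hx.1).not_gt (h.trans_lt hy.1).not_gt
    · exact iff_of_true (hx.2.trans_le h) (hy.2.trans_le h)
  -- Moving a subfamily inside `(l, u)` does not change its type over `E ∪ G`.
  have hmove : ∀ {Z : Type} (f g : Z → ℚ), (∀ z z', f z < f z' ↔ g z < g z') →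
      (∀ z, f z ∈ Set.Ioo l u) → (∀ z, g z ∈ Set.Ioo l u) →
      SameTypeOver L (E ∪ G) (fun z : Z × ι => I (f z.1) z.2) (fun z => I (g z.1) z.2) := by
    intro Z f g hfg hf hg
    have h1 := hind.sameTypeOver (Z := Z ⊕ G) (f := Sum.elim f q) (g := Sum.elim g q) (by
      rintro (z | z) (z' | z')
      · exact hfg z z'
      · exact hltq z' _ (hf z) _ (hg z)
      · exact hqlt z _ (hf z') _ (hg z')
      · rfl)
    refine h1.subst ?_ fun z => Or.inr ⟨(Sum.inl z.1, z.2), rfl, rfl⟩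
    rintro b (hb | hb)
    · exact Or.inl hb
    · exact Or.inr ⟨(Sum.inr ⟨b, hb⟩, i ⟨b, hb⟩), hqi _, hqi _⟩
  refine ⟨G, h, hGfin, fun k => ?_, ?_, fun k hk => ?_⟩
  · refine (hI (h k)).mono ?_
    rintro b ((hb | hb) | hb)
    · exact Or.inl hb
    · refine Or.inr (Set.mem_biUnion (x := q ⟨b, hb⟩) ?_ ⟨i ⟨b, hb⟩, (), hqi _⟩)
      exact fun hq => hlu (hh k) ⟨_, hq⟩
    · simp only [Set.mem_iUnion] at hb
      obtain ⟨j, hj, hb⟩ := hb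
      exact Or.inr (Set.mem_biUnion (x := h j) (fun hq => hj (h.injective hq)) hb)
  · rw [indiscernible_iff]
    intro m s t
    exact hmove (fun j => h (s j)) (fun j => h (t j)) (by simp) (fun j => hh _) fun j => hh _
  · rw [indiscernible_iff] at hk
    have h1 := hmove (Z := Unit) (fun _ => h k) (fun _ => k₀) (by simp) (fun _ => hh k)
      fun _ => hk₀lu
    have h2 : ∀ s : Fin m ↪o ι, SameTypeOver L (E ∪ G)
        (fun j : Fin m × Unit => I (h k) (s j.1)) (fun j => I k₀ (s j.1)) :=
      fun s => h1.comp fun j : Fin m × Unit => ((), s j.1)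
    exact hG (((h2 s).symm.trans (hk m s t)).trans (h2 t))

/-- If the sequences `I k` are witnesses of `1`-independence for a finite tuple of realizations
`d` of `p`, then `p` is `1`-independent. When the last entry of `d` is removed, either the family
stays mutually indiscernible over the remaining ones, which can then be added to the base, or there
are witnesses for the remaining ones. -/
theorem exists_isOneIndependentOver_of_tuple {n : ℕ} {p : Set (L[[A]].Formula (Fin n))}
    {ι : Type w} [LinearOrder ι] [Infinite ι] (m : ℕ) (hAB : A ⊆ B) (hfin : (B \ A).Finite)
    {d : Fin m × Fin n → C} (hd : d ∈ tuplesIn {d | Realizes p d} m) {I : ℚ → ι → C}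
    (hI : MutuallyIndiscernible L B fun k i (_ : Unit) => I k i)
    (hind : Indiscernible L (B ∪ Set.range d) I)
    (hn : ∀ k, ¬ Indiscernible L (B ∪ Set.range d) fun i (_ : Unit) => I k i) :
    ∃ A', A ⊆ A' ∧ (A' \ A).Finite ∧ IsOneIndependentOver p A' := by
  induction m generalizing B I with
  | zero =>
    refine absurd ((hI 0).mono ?_) (hn 0)
    simp [Set.range_eq_empty]
  | succ m ih =>
    let d' : Fin m × Fin n → C := fun z => d (z.1.castSucc, z.2)
    let d₀ : Fin n → C := fun s => d (Fin.last m, s)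
    have hrange : Set.range d = Set.range d' ∪ Set.range d₀ := by
      ext x
      constructor
      · rintro ⟨⟨j, s⟩, rfl⟩
        induction j using Fin.lastCases with
        | last => exact Or.inr ⟨s, rfl⟩
        | cast j => exact Or.inl ⟨(j, s), rfl⟩
      · rintro (⟨z, rfl⟩ | ⟨s, rfl⟩) <;> exact ⟨_, rfl⟩
    rw [hrange, ← Set.union_assoc] at hind hn
    by_cases hmut : MutuallyIndiscernible L (B ∪ Set.range d') fun k i (_ : Unit) => I k i
    -- The remaining entries can be added to the base, leaving `d₀` as the only realization.
    · refine ⟨B ∪ Set.range d', hAB.trans Set.subset_union_left, ?_, d₀, hd (Fin.last m), ι,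
        inferInstance, inferInstance, fun k => I k, hmut.comp Nat.cast_injective, ?_,
        fun k => hn k⟩
      · exact (hfin.union (Set.finite_range d')).subset (by
          rw [Set.union_sdiff_distrib]
          exact Set.union_subset_union_right _ Set.sdiff_subset)
      · exact hind.comp (OrderEmbedding.ofStrictMono (fun k : ℕ => (k : ℚ)) Nat.strictMono_cast)
    · obtain ⟨G, h, hG, h1, h2, h3⟩ := exists_finite_of_not_mutuallyIndiscernible hI
        (hind.mono Set.subset_union_left) hmut
      rw [Set.union_right_comm] at h2 h3
      refine ih (hAB.trans Set.subset_union_left) ?_ (fun j => hd j.castSucc) h1 h2 h3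
      exact (hfin.union hG).subset (by
          rw [Set.union_sdiff_distrib]
          exact Set.union_subset_union_right _ Set.sdiff_subset)

/-- A sequence of singletons which is shattered by tuples of elements of `D` can be cut into blocks
and stretched to a family of sequences indexed by `ℚ`, witnessing `1`-independence for tuples of
elements of `D`. -/
theorem ShattersFinite.exists_mutuallyIndiscernible (hC : IsSaturated L C κ) (hκ : ℵ₀ < κ)
    (hB : #B < κ) {σ : Type} [Finite σ] {D : Set (σ → C)} (hD : IsTypeDefinable L B D) {r : ℕ}
    {φ : L.Formula (σ ⊕ (Unit ⊕ Fin r))} {e : Fin r → C} (he : ∀ i, e i ∈ B) {c : ℕ → C}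
    (h : ShattersFinite φ D fun k => Sum.elim (fun _ => c k) e) :
    ∃ d ∈ D, ∃ I : ℚ → ULift.{w} ℕ → C,
      (MutuallyIndiscernible L B fun k i (_ : Unit) => I k i) ∧
      Indiscernible L (B ∪ Set.range d) I ∧
      ∀ k, ¬ Indiscernible L (B ∪ Set.range d) fun i (_ : Unit) => I k i := by
  classical
  have _ : Countable (ℕ ×ₗ ULift.{w} ℕ) := inferInstanceAs (Countable (ℕ × ULift.{w} ℕ))
  obtain ⟨b, hb, hEM, hsh⟩ := h.exists_indiscernible hC hκ hB hD (X := ℕ ×ₗ ULift.{w} ℕ)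
    (lift_mk_lt_of_countable hκ _)
  -- That certain entries are the parameters `e` is a formula over `B`, so it is preserved.
  have hbe : ∀ x i, b x (Sum.inr i) = e i := by
    intro x i
    have := hEM (Language.Term.equal (Language.var (Sum.inr (Sum.inr i)))
      (Language.var (Sum.inl ⟨e i, he i⟩))) (fun k => by simp [Language.Formula.realize_equal]) x
    simpa [Language.Formula.realize_equal] using this
  have hbe' : ∀ x, b x = Sum.elim (fun _ => b x (Sum.inl ())) e := by
    intro x
    funext z
    rcases z with z | i
    · rfl
    · exact hbe x i
  obtain ⟨d, hd, hφ⟩ := hsh {x | (ofLex x).2.down = 0}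
  let J : ℕ → ULift.{w} ℕ → C := fun k i => b (toLex (k, i)) (Sum.inl ())
  obtain ⟨I, hI, hIEM⟩ := hC.exists_indiscernible hκ.le
    (mk_union_range_lt hκ.le hB (lift_mk_lt_of_countable hκ _) d) (X := ℚ)
    (lift_mk_lt_of_countable hκ _) J
  refine ⟨d, hd, I, ?_, hI, fun k hk => ?_⟩
  -- Mutual indiscernibility of the blocks `J` is expressed by formulas, hence inherited by `I`.
  · refine mutuallyIndiscernible_of_sameTypeOver fun r k f g _ hfg χ => ?_
    let F : Finset ℚ := Finset.univ.image k
    have hF : ∀ z, ∃ j, F.orderEmbOfFin rfl j = k z := by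
      intro z
      have : k z ∈ Set.range (F.orderEmbOfFin rfl) := by
        rw [Finset.range_orderEmbOfFin]
        simp [F]
      exact this
    choose h hh using hF
    let l (f : Fin r → ULift.{w} ℕ) : B ⊕ Fin r →
        ↑(B ∪ Set.range d) ⊕ (Fin F.card × ULift.{w} ℕ) :=
      Sum.map (fun b => ⟨b.1, Or.inl b.2⟩) fun z => (h z, f z)
    have hl : ∀ (f : Fin r → ULift.{w} ℕ) (v : Fin F.card × ULift.{w} ℕ → C),
        Sum.elim ((↑) : ↑(B ∪ Set.range d) → C) v ∘ l f =
          Sum.elim ((↑) : B → C) fun z => v (h z, f z) := by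
      intro f v
      funext z
      rcases z with z | z <;> rfl
    have key := hIEM F.card (F.orderEmbOfFin rfl) ((χ.relabel (l f)).iff (χ.relabel (l g))) (by
      intro t
      rw [Language.Formula.realize_iff, Language.Formula.realize_relabel,
        Language.Formula.realize_relabel, hl, hl]
      refine (hb.sameTypeOver (f := fun z => toLex (t (h z), f z))
        (g := fun z => toLex (t (h z), g z)) ?_).comp (fun z => (z, Sum.inl ())) χ
      intro z z'
      simp only [Prod.Lex.toLex_lt_toLex]
      refine or_congr_right (and_congr_right fun hz => hfg z z' ?_)
      rw [← hh, ← hh, t.injective hz])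
    rw [Language.Formula.realize_iff, Language.Formula.realize_relabel,
      Language.Formula.realize_relabel, hl, hl] at key
    simpa only [hh] using key
  -- So is the difference of the first two elements of each sequence with respect to `φ`.
  · let l (i : ULift.{w} ℕ) : σ ⊕ (Unit ⊕ Fin r) →
        ↑(B ∪ Set.range d) ⊕ (Fin 1 × ULift.{w} ℕ) :=
      Sum.elim (fun s => Sum.inl ⟨d s, Or.inr ⟨s, rfl⟩⟩)
        (Sum.elim (fun _ => Sum.inr (0, i)) fun j => Sum.inl ⟨e j, Or.inl (he j)⟩)
    have hl : ∀ (i : ULift.{w} ℕ) (v : Fin 1 × ULift.{w} ℕ → C),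
        Sum.elim ((↑) : ↑(B ∪ Set.range d) → C) v ∘ l i =
          Sum.elim d (Sum.elim (fun _ => v (0, i)) e) := by
      intro i v
      funext z
      rcases z with z | z | z <;> rfl
    have key := hIEM 1 (OrderEmbedding.ofStrictMono (fun _ => k) (Subsingleton.strictMono _))
      (φ.relabel (l ⟨0⟩) ⊓ (φ.relabel (l ⟨1⟩)).not) (by
        intro t
        rw [Language.Formula.realize_inf, Language.Formula.realize_not,
          Language.Formula.realize_relabel, Language.Formula.realize_relabel, hl, hl, ← hbe',
          ← hbe', hφ, hφ]
        simp)
    rw [Language.Formula.realize_inf, Language.Formula.realize_not,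
      Language.Formula.realize_relabel, Language.Formula.realize_relabel, hl, hl] at key
    have h1 : SameTypeOver L (B ∪ Set.range d) (fun _ : Fin 1 × Unit => I k ⟨0⟩)
        (fun _ => I k ⟨1⟩) :=
      hk.sameTypeOver (Z := Fin 1) (f := fun _ => ⟨0⟩) (g := fun _ => ⟨1⟩) (by simp)
    have h2 : SameTypeOver L ∅ (Sum.elim d (Sum.elim (fun _ : Unit => I k ⟨0⟩) e))
        (Sum.elim d (Sum.elim (fun _ => I k ⟨1⟩) e)) := by
      refine h1.subst (by simp) ?_
      rintro (s | s | j)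
      · exact Or.inl ⟨Or.inr ⟨s, rfl⟩, rfl⟩
      · exact Or.inr ⟨(0, ()), rfl, rfl⟩
      · exact Or.inl ⟨Or.inl (he j), rfl⟩
    exact key.2 ((SameType.comp h2 Sum.inr φ).1 key.1)

theorem not_isOneDependent_of_hasIP (hC : IsSaturated L C κ)
    (hlen : shrinkingLength L A < Cardinal.lift.{max u v} κ) {n : ℕ}
    {p : Set (L[[A]].Formula (Fin n))} (h : HasIP L {d | Realizes p d}) : ¬ IsOneDependent p := by
  have hκ := aleph0_lt_of_shrinkingLength_lt hlen
  have h1 := not_singletonShrinking_of_hasIP hC hlen h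
  simp only [SingletonShrinking, not_forall, not_exists] at h1
  obtain ⟨A', hA', hfin, a, hap, ha, c, hn⟩ := h1
  obtain ⟨m, r, φ, e, c', hsh⟩ := exists_shattersFinite_singletons hC hlen hA' hfin
    (D := {d | Realizes p d}) hap ha hn
  have hfin' : ((A' ∪ Set.range e) \ A).Finite :=
    (hfin.union (Set.finite_range e)).subset (by
      rw [Set.union_sdiff_distrib]
      exact Set.union_subset_union_right _ Set.sdiff_subset)
  have hAB : A ⊆ A' ∪ Set.range e := hA'.trans Set.subset_union_left
  have hB : #(↑(A' ∪ Set.range e) : Type w) < κ := by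
    rw [← Cardinal.lift_lt.{w, max u v}]
    refine (lift_mk_union_finite_le (L := L) hfin').trans_lt ((Order.lt_succ _).trans ?_)
    rwa [← shrinkingLength_eq_succ]
  obtain ⟨d, hd, I, hI, hind, hnI⟩ := hsh.exists_mutuallyIndiscernible hC hκ hB
    (((isTypeDefinable_realizes p).tuplesIn m).mono hAB) fun i => Or.inr ⟨i, rfl⟩
  obtain ⟨A'', h2, h3, h4⟩ := exists_isOneIndependentOver_of_tuple m hAB hfin' hd hI hind hnI
  exact fun h5 => h5 A'' h2 h3 h4

end OneIndependence

end DpRank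

/-- `C` is the monster model of its complete theory `T = Th(C)`: it is `κ`-saturated for a cardinal
`κ` that is large with respect to `T` and the parameter set `A`. -/
theorem mainTheorem5 {L : FirstOrder.Language.{u, v}} {C : Type w} [L.Structure C]
    (κ : Cardinal.{w}) (hC : DpRank.IsSaturated L C κ)
    (A : Set C) (hκ : DpRank.shrinkingLength L A < Cardinal.lift.{max u v} κ)
    (n : ℕ) (p : Set (L[[A]].Formula (Fin n))) (hp : DpRank.IsConsistent p) :
    (DpRank.IsOneDependent p ↔ DpRank.IsDependent κ p) ∧
      (DpRank.IsDependent κ p ↔ DpRank.SingletonShrinking p) := by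
  have h1 : DpRank.IsDependent κ p ↔ ¬ DpRank.HasIP L {d | DpRank.Realizes p d} :=
    ⟨fun h h' => DpRank.not_isDependent_of_hasIP hC hκ h' h,
      DpRank.isDependent_of_not_hasIP hC hκ⟩
  have h2 : DpRank.IsOneDependent p ↔ ¬ DpRank.HasIP L {d | DpRank.Realizes p d} :=
    ⟨fun h h' => DpRank.not_isOneDependent_of_hasIP hC hκ h' h,
      fun h A' hA' _ hind => h (hind.hasIP hC hκ hA')⟩
  have h3 : DpRank.SingletonShrinking p ↔ ¬ DpRank.HasIP L {d | DpRank.Realizes p d} :=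
    ⟨fun h h' => DpRank.not_singletonShrinking_of_hasIP hC hκ h' h,
      DpRank.singletonShrinking_of_not_hasIP hC hκ⟩
  exact ⟨h2.trans h1.symm, h1.trans h3.symm⟩
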